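/- Let $d\ge 3$ and $\kappa>0$. For $s>0$ let $p_s(x)=(2\pi s)^{-d/2}e^{-|x|^2/(2s)}$ be the Brownian heat kernel on $\mathbb R^d$, and write $\pi_s u(x)=\int p_s(y-x)u(y)\,dy$. Let $\widetilde{\mathcal X}$ be the set of empty, finite or countable collections (with multiplicity) $\xi=\{\tilde\alpha_i\}_{i\in I}$ of orbits, under translations of $\mathbb R^d$, of sub-probability measures $\alpha_i$ on $\mathbb R^d$ with $\sum_{i\in I}\alpha_i(\mathbb R^d)\le 1$. For a sub-probability measure $\alpha$ on $\mathbb R^d$ and $t,\varepsilon,\delta>0$ define $$J_t(\alpha)=\sup_{u}\;-\int\log\Big(\frac{\pi_t u}{u}\Big)\,d\alpha,$$ the supremum being over measurable $u:\mathbb R^d\to(0,\infty)$ that are bounded and bounded away from $0$; $$\Gamma(\alpha)=\int_{\mathbb R^d}\Big(1-e^{-\kappa\frac{d\alpha}{dx}(x)}\Big)dx\ \text{ if }\alpha\text{ has a density with respect to Lebesgue measure},\qquad \Gamma(\alpha)=+\infty\ \text{ otherwise};$$ $$\Gamma_\delta(\alpha)=\int_{\mathbb R^d}\Big(1-e^{-\kappa\,(p_{\delta/d}*\alpha)(x)}\Big)dx,\qquad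 \Psi_\varepsilon(\alpha)=\int_{\mathbb R^d}\Big(1-e^{-\frac{\kappa}{\varepsilon}\int_0^\varepsilon (p_{s/d}*\alpha)(x)\,ds}\Big)dx .$$ These functionals are translation invariant. For $\xi=\{\tilde\alpha_i\}_{i\in I}\in\widetilde{\mathcal X}$ put $\tilde J_t(\xi)=\sum_{i}J_t(\alpha_i)$ and $$\tilde\Gamma(\xi)=\sum_{i}\Gamma(\alpha_i)+\kappa\Big(1-\sum_i\alpha_i(\mathbb R^d)\Big),$$ and define $\tilde\Gamma_\delta(\xi)$ and $\tilde\Psi_\varepsilon(\xi)$ in the same way from $\Gamma_\delta$ and $\Psi_\varepsilon$. Then, for every $K>0$, $$\lim_{\varepsilon\downarrow 0}\ \sup_{\xi\in\widetilde{\mathcal X}:\ \tilde J_{\varepsilon/d}(\xi)\le K\varepsilon}\big|\tilde\Gamma(\xi)-\tilde\Psi_\varepsilon(\xi)\big|=0 .$$ Moreover, for every $K>0$ there exists $C\in(0,\infty)$ such that for all $\varepsilon>0$ and all $\delta\ge\varepsilon$, $$\sup_{\xi\in\widetilde{\mathcal X}:\ \tilde J_{\varepsilon/d}(\xi)\le K\varepsilon}\big|\tilde\Gamma(\xi)-\tilde\Gamma_\delta(\xi)\big|\le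 C\sqrt{\delta}.$$ -/

import Mathlib

open MeasureTheory Filter Topology
open scoped ENNReal

noncomputable section

namespace SwissCheese

/-- `ℝ^d` with the Euclidean norm. -/
abbrev E (d : ℕ) : Type := EuclideanSpace ℝ (Fin d)

/-! ### Heat kernel -/

/-- The Brownian heat kernel `p_s(x) = (2πs)^{-d/2} exp(-|x|²/(2s))`, used for `s > 0`. -/
def heatKernel {d : ℕ} (s : ℝ) (x : E d) : ℝ :=
  (2 * Real.pi * s) ^ (-(d : ℝ) / 2) * Real.exp (-‖x‖ ^ 2 / (2 * s))

/-- The Brownian semigroup acting on functions, `(π_t u)(x) = ∫ p_t(y - x) u(y) dy`. -/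
def heatSemigroup {d : ℕ} (t : ℝ) (u : E d → ℝ) (x : E d) : ℝ :=
  ∫ y, heatKernel t (y - x) * u y

/-- The density `(p_s * α)(x) = ∫ p_s(x - y) α(dy)`. -/
def heatConv {d : ℕ} (s : ℝ) (α : Measure (E d)) (x : E d) : ℝ≥0∞ :=
  ∫⁻ y, ENNReal.ofReal (heatKernel s (x - y)) ∂α

/-- `t ↦ 1 - e^{-t}` on `[0, ∞]`, with `e^{-∞} = 0`. -/
def oneSubExpNeg (t : ℝ≥0∞) : ℝ≥0∞ :=
  if t = ⊤ then 1 else ENNReal.ofReal (1 - Real.exp (-t.toReal))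

/-! ### Functionals of a measure -/

/-- Test functions of the Donsker-Varadhan formula: measurable, bounded above, and bounded
away from zero. -/
def IsTestFun {d : ℕ} (u : E d → ℝ) : Prop :=
  Measurable u ∧ ∃ a b : ℝ, 0 < a ∧ ∀ x, a ≤ u x ∧ u x ≤ b

/-- The Donsker-Varadhan rate function of the Markov chain with kernel `π_t`,
`J_t(α) = sup_{u > 0} - ∫ log (π_t u / u) dα`. The value at `u = 1` is zero for `t > 0`, so that
truncating negative values by `ENNReal.ofReal` does not change the supremum. -/
def rateJ {d : ℕ} (t : ℝ) (α : Measure (E d)) : ℝ≥0∞ :=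
  ⨆ (u : E d → ℝ) (_ : IsTestFun u),
    ENNReal.ofReal (-∫ x, Real.log (heatSemigroup t u x / u x) ∂α)

open Classical in
/-- `Γ(α) = ∫ (1 - e^{-κ φ²})` where `φ² = dα/dx`, and `+∞` if `α` has no density. -/
def Gam {d : ℕ} (κ : ℝ) (α : Measure (E d)) : ℝ≥0∞ :=
  if α ≪ volume then ∫⁻ x, oneSubExpNeg (ENNReal.ofReal κ * α.rnDeriv volume x) else ⊤

/-- `Γ_δ(α) = ∫ (1 - e^{-κ (p_{δ/d} * α)(x)}) dx`. -/
def GamSmooth {d : ℕ} (κ δ : ℝ) (α : Measure (E d)) : ℝ≥0∞ :=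
  ∫⁻ x, oneSubExpNeg (ENNReal.ofReal κ * heatConv (δ / d) α x)

/-- `Ψ_ε(α) = ∫ (1 - e^{-(κ/ε) ∫_0^ε (p_{s/d} * α)(x) ds}) dx`. -/
def Psi {d : ℕ} (κ ε : ℝ) (α : Measure (E d)) : ℝ≥0∞ :=
  ∫⁻ x, oneSubExpNeg
    (ENNReal.ofReal (κ / ε) * ∫⁻ s in Set.Ioc (0 : ℝ) ε, heatConv (s / d) α x)

/-! ### Translation invariance -/

/-- The shift `θ_x α`, with `∫ f d(θ_x α) = ∫ f(u + x) α(du)`. -/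
def shift {d : ℕ} (x : E d) (α : Measure (E d)) : Measure (E d) :=
  α.map (· + x)

theorem shift_univ {d : ℕ} (x : E d) (α : Measure (E d)) :
    shift x α Set.univ = α Set.univ := by
  rw [shift, Measure.map_apply (measurable_add_const x) MeasurableSet.univ, Set.preimage_univ]

theorem shift_zero {d : ℕ} (α : Measure (E d)) : shift 0 α = α := by
  simp [shift]

theorem shift_shift {d : ℕ} (x y : E d) (α : Measure (E d)) :
    shift y (shift x α) = shift (x + y) α := by
  rw [shift, shift, shift, Measure.map_map (measurable_add_const y) (measurable_add_const x)]
  congr 1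
  funext z
  simp [add_assoc]

theorem heatSemigroup_shift {d : ℕ} (t : ℝ) (u : E d → ℝ) (x y : E d) :
    heatSemigroup t (fun z => u (z + x)) y = heatSemigroup t u (y + x) := by
  have h := integral_add_right_eq_self (μ := (volume : Measure (E d)))
    (fun z => heatKernel t (z - (y + x)) * u z) x
  simpa [heatSemigroup, add_sub_add_right_eq_sub] using h

theorem rateJ_shift_le {d : ℕ} (t : ℝ) (x : E d) (α : Measure (E d)) :
    rateJ t (shift x α) ≤ rateJ t α := by
  refine iSup₂_le fun u hu => ?_
  have hv : IsTestFun (fun z => u (z + x)) := by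
    obtain ⟨hm, a, b, ha, hab⟩ := hu
    exact ⟨hm.comp (measurable_add_const x), a, b, ha, fun z => hab _⟩
  refine le_trans (le_of_eq ?_) (le_iSup₂_of_le (fun z => u (z + x)) hv le_rfl)
  have hemb : MeasurableEmbedding (fun z : E d => z + x) := measurableEmbedding_addRight x
  rw [shift, hemb.integral_map]
  simp only [heatSemigroup_shift]

theorem rateJ_shift {d : ℕ} (t : ℝ) (x : E d) (α : Measure (E d)) :
    rateJ t (shift x α) = rateJ t α := by
  refine le_antisymm (rateJ_shift_le t x α) ?_
  have h := rateJ_shift_le t (-x) (shift x α)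
  rwa [shift_shift, add_neg_cancel, shift_zero] at h

theorem heatConv_shift {d : ℕ} (s : ℝ) (x z : E d) (α : Measure (E d)) :
    heatConv s (shift x α) (z + x) = heatConv s α z := by
  have hemb : MeasurableEmbedding (fun z : E d => z + x) := measurableEmbedding_addRight x
  rw [heatConv, shift, hemb.lintegral_map, heatConv]
  simp only [add_sub_add_right_eq_sub]

theorem GamSmooth_shift {d : ℕ} (κ δ : ℝ) (x : E d) (α : Measure (E d)) :
    GamSmooth κ δ (shift x α) = GamSmooth κ δ α := by
  rw [GamSmooth, ← lintegral_add_right_eq_self _ x]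
  simp only [heatConv_shift, GamSmooth]

theorem Psi_shift {d : ℕ} (κ ε : ℝ) (x : E d) (α : Measure (E d)) :
    Psi κ ε (shift x α) = Psi κ ε α := by
  rw [Psi, ← lintegral_add_right_eq_self _ x]
  simp only [heatConv_shift, Psi]

theorem volume_shift {d : ℕ} (x : E d) :
    shift x (volume : Measure (E d)) = volume :=
  map_add_right_eq_self volume x

theorem ac_shift {d : ℕ} (x : E d) {α : Measure (E d)} (h : α ≪ volume) :
    shift x α ≪ volume := by
  have h' := h.map (measurable_add_const x)
  rw [← volume_shift x]
  exact h'

theorem Gam_shift {d : ℕ} (κ : ℝ) (x : E d) (α : Measure (E d)) [SigmaFinite α] :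
    Gam κ (shift x α) = Gam κ α := by
  have hiff : shift x α ≪ volume ↔ α ≪ volume := by
    refine ⟨fun h => ?_, ac_shift x⟩
    have h' := ac_shift (-x) h
    rwa [shift_shift, add_neg_cancel, shift_zero] at h'
  unfold Gam
  by_cases h : α ≪ volume
  · rw [if_pos h, if_pos (hiff.2 h), ← lintegral_add_right_eq_self _ x]
    refine lintegral_congr_ae ?_
    have hemb : MeasurableEmbedding (fun z : E d => z + x) := measurableEmbedding_addRight x
    have hr := hemb.rnDeriv_map α (volume : Measure (E d))
    have hvol : (volume : Measure (E d)).map (fun z => z + x) = volume := volume_shift x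
    rw [hvol] at hr
    filter_upwards [hr] with z hz
    simp only [shift]
    rw [hz]
  · rw [if_neg h, if_neg (mt hiff.1 h)]

/-! ### Orbits and collections of orbits -/

/-- Sub-probability measures on `ℝ^d`. -/
def SubProb (d : ℕ) : Type := {α : Measure (E d) // α Set.univ ≤ 1}

/-- Two sub-probability measures are equivalent if one is a shift of the other. -/
instance shiftSetoid (d : ℕ) : Setoid (SubProb d) where
  r α β := ∃ x : E d, β.1 = shift x α.1
  iseqv :=
    { refl := fun α => ⟨0, (shift_zero α.1).symm⟩
      symm := by
        rintro α β ⟨x, hx⟩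
        exact ⟨-x, by rw [hx, shift_shift, add_neg_cancel, shift_zero]⟩
      trans := by
        rintro α β γ ⟨x, hx⟩ ⟨y, hy⟩
        exact ⟨x + y, by rw [hy, hx, shift_shift]⟩ }

/-- The space of orbits of sub-probability measures under shifts. -/
def Orbit (d : ℕ) : Type := Quotient (shiftSetoid d)

namespace Orbit

variable {d : ℕ}

/-- The total mass of an orbit. -/
def mass : Orbit d → ℝ≥0∞ :=
  Quotient.lift (fun α : SubProb d => α.1 Set.univ) (by
    rintro α β ⟨x, hx⟩
    simp only [hx, shift_univ])

/-- `J_t` on orbits. -/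
def J (t : ℝ) : Orbit d → ℝ≥0∞ :=
  Quotient.lift (fun α : SubProb d => rateJ t α.1) (by
    rintro α β ⟨x, hx⟩
    simp only [hx, rateJ_shift])

/-- `Γ` on orbits. -/
def Γ (κ : ℝ) : Orbit d → ℝ≥0∞ :=
  Quotient.lift (fun α : SubProb d => Gam κ α.1) (by
    rintro α β ⟨x, hx⟩
    have : IsFiniteMeasure α.1 := ⟨lt_of_le_of_lt α.2 ENNReal.one_lt_top⟩
    simp only [hx, Gam_shift])

/-- `Γ_δ` on orbits. -/
def Γδ (κ δ : ℝ) : Orbit d → ℝ≥0∞ :=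
  Quotient.lift (fun α : SubProb d => GamSmooth κ δ α.1) (by
    rintro α β ⟨x, hx⟩
    simp only [hx, GamSmooth_shift])

/-- `Ψ_ε` on orbits. -/
def Ψ (κ ε : ℝ) : Orbit d → ℝ≥0∞ :=
  Quotient.lift (fun α : SubProb d => Psi κ ε α.1) (by
    rintro α β ⟨x, hx⟩
    simp only [hx, Psi_shift])

end Orbit

/-- An empty, finite or countably infinite family of orbits of total mass at most one, indexed by
a set of natural numbers. -/
structure OrbitFamily (d : ℕ) where
  /-- The index set. -/
  I : Set ℕ
  /-- The orbits. -/
  orbit : I → Orbit d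
  mass_le : ∑' i, (orbit i).mass ≤ 1

/-- Families that differ by a relabelling of the indices are equivalent. -/
instance relabelSetoid (d : ℕ) : Setoid (OrbitFamily d) where
  r ξ η := ∃ e : ξ.I ≃ η.I, ∀ i, η.orbit (e i) = ξ.orbit i
  iseqv :=
    { refl := fun ξ => ⟨Equiv.refl _, fun _ => rfl⟩
      symm := by
        rintro ξ η ⟨e, he⟩
        exact ⟨e.symm, fun i => by rw [← he, e.apply_symm_apply]⟩
      trans := by
        rintro ξ η ζ ⟨e, he⟩ ⟨f, hf⟩
        exact ⟨e.trans f, fun i => by rw [Equiv.trans_apply, hf, he]⟩ }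

/-- The space `X̃` of empty, finite or countable collections (with multiplicity) of orbits of
sub-probability measures with total mass at most one. -/
def XTilde (d : ℕ) : Type := Quotient (relabelSetoid d)

namespace XTilde

variable {d : ℕ}

/-- `∑_{i ∈ I} F(α̃_i)` for `ξ = {α̃_i}_{i ∈ I}`. -/
def sum (F : Orbit d → ℝ≥0∞) : XTilde d → ℝ≥0∞ :=
  Quotient.lift (fun ξ : OrbitFamily d => ∑' i, F (ξ.orbit i)) (by
    rintro ξ η ⟨e, he⟩
    simp only [← he]
    exact e.tsum_eq fun j => F (η.orbit j))

/-- `κ (1 - ∑_i α_i(ℝ^d))`; the sum is at most one, so the subtraction is not truncated. -/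
def deficit (κ : ℝ) (ξ : XTilde d) : ℝ≥0∞ :=
  ENNReal.ofReal κ * (1 - ξ.sum Orbit.mass)

/-- `J̃_t(ξ) = ∑_i J_t(α_i)`. -/
def J (t : ℝ) (ξ : XTilde d) : ℝ≥0∞ := ξ.sum (Orbit.J t)

/-- `Γ̃(ξ) = ∑_i Γ(α_i) + κ (1 - ∑_i α_i(ℝ^d))`. -/
def Γ (κ : ℝ) (ξ : XTilde d) : ℝ≥0∞ := ξ.sum (Orbit.Γ κ) + ξ.deficit κ

/-- `Γ̃_δ(ξ)`. -/
def Γδ (κ δ : ℝ) (ξ : XTilde d) : ℝ≥0∞ := ξ.sum (Orbit.Γδ κ δ) + ξ.deficit κ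

/-- `Ψ̃_ε(ξ)`. -/
def Ψ (κ ε : ℝ) (ξ : XTilde d) : ℝ≥0∞ := ξ.sum (Orbit.Ψ κ ε) + ξ.deficit κ

end XTilde

/-- `|x - y|` for `x, y ∈ [0, ∞]`, computed in `EReal`; it equals `∞` as soon as `x` or `y` is
infinite (also when both are). -/
def absDiff (x y : ℝ≥0∞) : ℝ≥0∞ := ((x : EReal) - (y : EReal)).abs

end SwissCheese

end

namespace SwissCheese

variable {d : ℕ}

/-! If `J_t(α)` is finite at `t = ε/d`, then `α = φ² dx` with `φ ≥ 0`. Testing the Donsker-Varadhan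
formula with (truncations of) `φ` and using `-log r ≥ 1 - r` gives `⟨φ, (1 - π_t) φ⟩ ≤ J_t(α)`. By
symmetry of the heat kernel the left side is half of `∫ p_t(z) ‖φ(· + z) - φ‖₂² dz`, so the rate
controls the mean square increments of `φ` at the scale `√ε`
(`lintegral_heatKernel_sqIncr_le_rateJ`).

A longer increment is a sum of `n` equal short ones, which costs a factor `n²`. With `n² ≈ δ/ε`, the
same form at time `δ/d` is at most a constant times `(δ/ε) J` (`lintegral_heatKernel_sqIncr_le`).
Since `a² - b² = (a - b)(a + b)`, a weighted AM-GM inequality turns this into an `L¹` bound: `φ²`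
and its heat flow at time `δ/d` differ by at most `C √δ (J/ε + m)`, where `m` is the mass. As `t ↦ 1
- e^{-t}` is 1-Lipschitz, this bounds `|Γ - Γ_δ|`.

For `Ψ_ε`, times below `η ε` carry a fraction `η` of the average and cost at most `2 η m`; for later
times the kernel is at most `η^{-d/2} p_{ε/d}`, to which the previous bound applies. Then `ε → 0` at
fixed small `η`.

All errors are linear in `(J, m)`, so they sum over a collection with only the total rate `≤ K ε`
and the total mass `≤ 1` entering; the mass deficit is common to both functionals and cancels. -/

/-! ### The heat kernel: mass, comparison of times, scaling -/

theorem heatKernel_nonneg {s : ℝ} (hs : 0 < s) (x : E d) : 0 ≤ heatKernel s x := by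
  unfold heatKernel; positivity

theorem measurable_heatKernel_uncurry :
    Measurable fun p : ℝ × E d => heatKernel p.1 p.2 := by
  unfold heatKernel; fun_prop

theorem measurable_heatKernel (s : ℝ) : Measurable (heatKernel s : E d → ℝ) := by
  unfold heatKernel; fun_prop

theorem integral_heatKernel {s : ℝ} (hs : 0 < s) : ∫ x : E d, heatKernel s x = 1 := by
  have h := GaussianFourier.integral_rexp_neg_mul_sq_norm (V := E d) (b := 1 / (2 * s))
    (by positivity)
  have h2 : ∀ x : E d, heatKernel s x =
      (2 * Real.pi * s) ^ (-(d : ℝ) / 2) * Real.exp (-(1 / (2 * s)) * ‖x‖ ^ 2) := by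
    intro x
    unfold heatKernel
    congr 2
    ring
  simp_rw [h2]
  rw [integral_const_mul, h, finrank_euclideanSpace, Fintype.card_fin,
    show Real.pi / (1 / (2 * s)) = 2 * Real.pi * s by field_simp, ← Real.rpow_add (by positivity)]
  ring_nf
  simp

theorem integrable_heatKernel {s : ℝ} (hs : 0 < s) : Integrable (heatKernel s : E d → ℝ) :=
  integrable_of_integral_eq_one (integral_heatKernel hs)

theorem lintegral_heatKernel {s : ℝ} (hs : 0 < s) :
    ∫⁻ x : E d, ENNReal.ofReal (heatKernel s x) = 1 := by
  rw [← ofReal_integral_eq_lintegral_ofReal (integrable_heatKernel hs)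
    (.of_forall (heatKernel_nonneg hs)), integral_heatKernel hs, ENNReal.ofReal_one]

/-- The exponential factor increases with time, so only the ratio of the normalising constants is
lost. -/
theorem heatKernel_le {s t : ℝ} (hs : 0 < s) (hst : s ≤ t) (x : E d) :
    heatKernel s x ≤ (t / s) ^ ((d : ℝ) / 2) * heatKernel t x := by
  have ht := hs.trans_le hst
  unfold heatKernel
  rw [← mul_assoc]
  have h1 : (t / s) ^ ((d : ℝ) / 2) * (2 * Real.pi * t) ^ (-(d : ℝ) / 2) =
      (2 * Real.pi * s) ^ (-(d : ℝ) / 2) := by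
    rw [neg_div, Real.rpow_neg (by positivity), Real.rpow_neg (by positivity),
      ← div_eq_mul_inv, ← Real.div_rpow (by positivity) (by positivity),
      ← Real.inv_rpow (by positivity)]
    congr 1
    field_simp
  rw [h1]
  refine mul_le_mul_of_nonneg_left (Real.exp_le_exp.2 ?_) (by positivity)
  rw [neg_div, neg_div, neg_le_neg_iff]
  gcongr

/-- Brownian scaling. Integer dilations suffice, because increments will be cut into `n` equal
steps. -/
theorem heatKernel_smul {t : ℝ} (ht : 0 < t) {n : ℕ} (hn : 0 < n) (w : E d) :
    (n : ℝ) ^ d * heatKernel (n ^ 2 * t) ((n : ℝ) • w) = heatKernel t w := by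
  have hn' : (0 : ℝ) < n := by exact_mod_cast hn
  unfold heatKernel
  rw [← mul_assoc]
  congr 1
  · rw [show 2 * Real.pi * ((n : ℝ) ^ 2 * t) = (n : ℝ) ^ 2 * (2 * Real.pi * t) by ring,
      Real.mul_rpow (by positivity) (by positivity), ← mul_assoc, ← Real.rpow_natCast_mul hn'.le]
    rw [show ((2 : ℕ) : ℝ) * (-(d : ℝ) / 2) = -(d : ℝ) by push_cast; ring, Real.rpow_neg hn'.le,
      Real.rpow_natCast, mul_inv_cancel₀ (by positivity), one_mul]
  · rw [norm_smul, Real.norm_of_nonneg hn'.le]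
    congr 1
    field_simp

theorem lintegral_heatKernel_sq_mul {t : ℝ} (ht : 0 < t) {n : ℕ} (hn : 0 < n)
    (G : E d → ℝ≥0∞) :
    ∫⁻ z, ENNReal.ofReal (heatKernel (n ^ 2 * t) z) * G z =
      ∫⁻ w, ENNReal.ofReal (heatKernel t w) * G ((n : ℝ) • w) := by
  have hn' : (0 : ℝ) < n := by exact_mod_cast hn
  have hemb : MeasurableEmbedding (fun w : E d => (n : ℝ) • w) :=
    (Homeomorph.smulOfNeZero (n : ℝ) hn'.ne').measurableEmbedding
  have hmap := Measure.map_addHaar_smul (volume : Measure (E d)) hn'.ne'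
  have h := hemb.lintegral_map (μ := (volume : Measure (E d)))
    (fun z => ENNReal.ofReal (heatKernel (n ^ 2 * t) z) * G z)
  have hmap' : Measure.map (fun w : E d => (n : ℝ) • w) volume =
      ENNReal.ofReal |((n : ℝ) ^ Module.finrank ℝ (E d))⁻¹| • volume := hmap
  rw [hmap', lintegral_smul_measure, finrank_euclideanSpace, Fintype.card_fin,
    abs_of_pos (by positivity)] at h
  have h2 : ∀ w : E d, ENNReal.ofReal (heatKernel t w) * G ((n : ℝ) • w) =
      ENNReal.ofReal ((n : ℝ) ^ d) *
        (ENNReal.ofReal (heatKernel (n ^ 2 * t) ((n : ℝ) • w)) * G ((n : ℝ) • w)) := by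
    intro w
    rw [← heatKernel_smul ht hn w, ENNReal.ofReal_mul (by positivity), mul_assoc]
  simp_rw [h2]
  rw [lintegral_const_mul' _ _ ENNReal.ofReal_ne_top, ← h, smul_eq_mul, ← mul_assoc,
    ← ENNReal.ofReal_mul (by positivity), mul_inv_cancel₀ (by positivity), ENNReal.ofReal_one,
    one_mul]

/-! ### Increments -/

/-- `∫ (φ(x + z) - φ(x))² dx`. -/
noncomputable def sqIncr (φ : E d → ℝ) (z : E d) : ℝ≥0∞ :=
  ∫⁻ x, ENNReal.ofReal ((φ (x + z) - φ x) ^ 2)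

/-- `∫ |φ(x + z)² - φ(x)²| dx`. -/
noncomputable def absIncr (φ : E d → ℝ) (z : E d) : ℝ≥0∞ :=
  ∫⁻ x, ENNReal.ofReal |φ (x + z) ^ 2 - φ x ^ 2|

theorem measurable_sqIncr {φ : E d → ℝ} (hφ : Measurable φ) : Measurable (sqIncr φ) := by
  unfold sqIncr
  exact Measurable.lintegral_prod_right (f := fun z x : E d =>
    ENNReal.ofReal ((φ (x + z) - φ x) ^ 2)) (by fun_prop)

theorem measurable_absIncr {φ : E d → ℝ} (hφ : Measurable φ) : Measurable (absIncr φ) := by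
  unfold absIncr
  exact Measurable.lintegral_prod_right (f := fun z x : E d =>
    ENNReal.ofReal |φ (x + z) ^ 2 - φ x ^ 2|) (by fun_prop)

/-- Telescope into `n` steps of length `z` and apply Cauchy-Schwarz; by translation invariance every
step contributes the same integral. -/
theorem sqIncr_nsmul_le {φ : E d → ℝ} (hφ : Measurable φ) (n : ℕ) (z : E d) :
    sqIncr φ ((n : ℝ) • z) ≤ ENNReal.ofReal ((n : ℝ) ^ 2) * sqIncr φ z := by
  have hpt : ∀ x : E d, ENNReal.ofReal ((φ (x + (n : ℝ) • z) - φ x) ^ 2) ≤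
      ENNReal.ofReal n * ∑ k ∈ Finset.range n,
        ENNReal.ofReal ((φ (x + (k : ℝ) • z + z) - φ (x + (k : ℝ) • z)) ^ 2) := by
    intro x
    rw [← ENNReal.ofReal_sum_of_nonneg (fun _ _ => sq_nonneg _),
      ← ENNReal.ofReal_mul (Nat.cast_nonneg n)]
    refine ENNReal.ofReal_le_ofReal ?_
    have h := Finset.sum_range_sub (fun k : ℕ => φ (x + (k : ℝ) • z)) n
    simp only [Nat.cast_zero, zero_smul, add_zero] at h
    rw [← h]
    have h2 := sq_sum_le_card_mul_sum_sq (s := Finset.range n)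
      (f := fun k : ℕ => φ (x + ((k + 1 : ℕ) : ℝ) • z) - φ (x + (k : ℝ) • z))
    rw [Finset.card_range] at h2
    simpa [add_smul, add_assoc] using h2
  refine (lintegral_mono hpt).trans ?_
  rw [lintegral_const_mul' _ _ ENNReal.ofReal_ne_top, lintegral_finsetSum]
  · have : ∀ k : ℕ, ∫⁻ x : E d,
        ENNReal.ofReal ((φ (x + (k : ℝ) • z + z) - φ (x + (k : ℝ) • z)) ^ 2) = sqIncr φ z :=
      fun k => lintegral_add_right_eq_self
        (fun x => ENNReal.ofReal ((φ (x + z) - φ x) ^ 2)) ((k : ℝ) • z)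
    simp_rw [this]
    rw [Finset.sum_const, Finset.card_range, nsmul_eq_mul, ← mul_assoc, sq,
      ENNReal.ofReal_mul (Nat.cast_nonneg n), ENNReal.ofReal_natCast]
  · intro k _
    fun_prop

/-- The Dirichlet form at time `δ` is at most a multiple of `δ / t` times that at time `t ≤ δ`. -/
theorem lintegral_heatKernel_sqIncr_le {φ : E d → ℝ} (hφ : Measurable φ) {t δ : ℝ} (ht : 0 < t)
    (hδ : t ≤ δ) :
    ∫⁻ z, ENNReal.ofReal (heatKernel δ z) * sqIncr φ z ≤
      ENNReal.ofReal ((4 : ℝ) ^ ((d : ℝ) / 2) * 4 * (δ / t)) *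
        ∫⁻ z, ENNReal.ofReal (heatKernel t z) * sqIncr φ z := by
  -- This choice gives `δ ≤ n² t ≤ 4 δ`: the lower bound lets `p_{n² t}` dominate `p_δ` up to the
  -- factor `4^{d/2}`, and the upper bound turns the factor `n²` of the telescoping into `4 δ / t`.
  set n : ℕ := ⌈√(δ / t)⌉₊ with hn
  have h1 : 1 ≤ δ / t := (one_le_div ht).2 hδ
  have hsq : 1 ≤ √(δ / t) := Real.one_le_sqrt.2 h1
  have hn0 : 0 < n := Nat.ceil_pos.2 (by linarith)
  have hnl : √(δ / t) ≤ n := Nat.le_ceil _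
  have hnu : (n : ℝ) ≤ 2 * √(δ / t) := by
    have := Nat.ceil_lt_add_one (Real.sqrt_nonneg (δ / t))
    linarith
  have hss : √(δ / t) ^ 2 = δ / t := Real.sq_sqrt (by linarith)
  have hnl2 : δ ≤ n ^ 2 * t := by
    rw [← div_le_iff₀ ht, ← hss]
    gcongr
  have hnu2 : (n : ℝ) ^ 2 ≤ 4 * (δ / t) := by
    rw [← hss]
    nlinarith
  have hδ0 := ht.trans_le hδ
  calc ∫⁻ z, ENNReal.ofReal (heatKernel δ z) * sqIncr φ z
      ≤ ∫⁻ z, ENNReal.ofReal ((4 : ℝ) ^ ((d : ℝ) / 2)) *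
          (ENNReal.ofReal (heatKernel (n ^ 2 * t) z) * sqIncr φ z) := by
        refine lintegral_mono fun z => ?_
        rw [← mul_assoc, ← ENNReal.ofReal_mul (by positivity)]
        gcongr
        refine (heatKernel_le hδ0 hnl2 z).trans ?_
        have := heatKernel_nonneg (show 0 < (n : ℝ) ^ 2 * t by positivity) z
        gcongr
        rw [div_le_iff₀ hδ0]
        calc (n : ℝ) ^ 2 * t ≤ 4 * (δ / t) * t := by gcongr
          _ = 4 * δ := by field_simp
    _ = ENNReal.ofReal ((4 : ℝ) ^ ((d : ℝ) / 2)) *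
          ∫⁻ w, ENNReal.ofReal (heatKernel t w) * sqIncr φ ((n : ℝ) • w) := by
        rw [lintegral_const_mul' _ _ ENNReal.ofReal_ne_top, lintegral_heatKernel_sq_mul ht hn0]
    _ ≤ ENNReal.ofReal ((4 : ℝ) ^ ((d : ℝ) / 2)) *
          ∫⁻ w, ENNReal.ofReal (4 * (δ / t)) *
            (ENNReal.ofReal (heatKernel t w) * sqIncr φ w) := by
        refine mul_le_mul_right (lintegral_mono fun w => ?_) _
        refine (mul_le_mul_right (sqIncr_nsmul_le hφ n w) _).trans ?_
        rw [mul_left_comm]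
        gcongr
    _ = _ := by
        rw [lintegral_const_mul' _ _ ENNReal.ofReal_ne_top, ← mul_assoc,
          ← ENNReal.ofReal_mul (by positivity), mul_assoc (4 ^ _)]

/-- AM-GM on `|a - b| |a + b|`; the weight `l` stays free and is later balanced against the time
scale. -/
theorem absIncr_le {φ : E d → ℝ} (hφ : Measurable φ) {l : ℝ} (hl : 0 < l) (z : E d) :
    absIncr φ z ≤ ENNReal.ofReal (l / 2) * sqIncr φ z +
      ENNReal.ofReal (2 / l) * ∫⁻ x, ENNReal.ofReal (φ x ^ 2) := by
  have hpt : ∀ x : E d, ENNReal.ofReal |φ (x + z) ^ 2 - φ x ^ 2| ≤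
      ENNReal.ofReal (l / 2) * ENNReal.ofReal ((φ (x + z) - φ x) ^ 2) +
      ENNReal.ofReal (1 / l) * (ENNReal.ofReal (φ (x + z) ^ 2) + ENNReal.ofReal (φ x ^ 2)) := by
    intro x
    rw [← ENNReal.ofReal_add (sq_nonneg _) (sq_nonneg _), ← ENNReal.ofReal_mul (by positivity),
      ← ENNReal.ofReal_mul (by positivity), ← ENNReal.ofReal_add (by positivity) (by positivity)]
    refine ENNReal.ofReal_le_ofReal ?_
    generalize φ (x + z) = a
    generalize φ x = b
    have h1 : |a ^ 2 - b ^ 2| = |a - b| * |a + b| := by rw [← abs_mul]; ring_nf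
    -- The slack is a sum of squares, since `|a - b|² + |a + b|² = 2 (a² + b²)`.
    have h2 : l / 2 * (a - b) ^ 2 + 1 / l * (a ^ 2 + b ^ 2) - |a - b| * |a + b|
        = (l * |a - b| - |a + b|) ^ 2 / (2 * l) + (a - b) ^ 2 / (2 * l) := by
      rw [sub_sq (l * _), mul_pow, sq_abs, sq_abs]
      field_simp
      ring
    have h3 : 0 ≤ (l * |a - b| - |a + b|) ^ 2 / (2 * l) + (a - b) ^ 2 / (2 * l) := by positivity
    rw [h1]; linarith
  refine (lintegral_mono hpt).trans (le_of_eq ?_)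
  rw [lintegral_add_left (by fun_prop), lintegral_const_mul' _ _ ENNReal.ofReal_ne_top,
    lintegral_const_mul' _ _ ENNReal.ofReal_ne_top, lintegral_add_left (by fun_prop),
    lintegral_add_right_eq_self (fun x => ENNReal.ofReal (φ x ^ 2)) z, ← two_mul, ← mul_assoc,
    mul_comm _ (2 : ℝ≥0∞), ← show ENNReal.ofReal (2 / l) = 2 * ENNReal.ofReal (1 / l) by
      rw [div_eq_mul_one_div, ENNReal.ofReal_mul zero_le_two, ENNReal.ofReal_ofNat], sqIncr]

/-- A bound without regularity, for the short times in `Ψ_ε`. -/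
theorem absIncr_le_two_mul {φ : E d → ℝ} (hφ : Measurable φ) (z : E d) :
    absIncr φ z ≤ 2 * ∫⁻ x, ENNReal.ofReal (φ x ^ 2) := by
  have hpt : ∀ x : E d, ENNReal.ofReal |φ (x + z) ^ 2 - φ x ^ 2| ≤
      ENNReal.ofReal (φ (x + z) ^ 2) + ENNReal.ofReal (φ x ^ 2) := by
    intro x
    rw [← ENNReal.ofReal_add (sq_nonneg _) (sq_nonneg _)]
    refine ENNReal.ofReal_le_ofReal (abs_le.2 ⟨?_, ?_⟩) <;>
      linarith [sq_nonneg (φ (x + z)), sq_nonneg (φ x)]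
  refine (lintegral_mono hpt).trans (le_of_eq ?_)
  rw [lintegral_add_left (by fun_prop),
    lintegral_add_right_eq_self (fun x => ENNReal.ofReal (φ x ^ 2)) z, ← two_mul]

/-! ### The rate function -/

theorem integral_heatKernel_sub {t : ℝ} (ht : 0 < t) (x : E d) :
    ∫ y, heatKernel t (y - x) = 1 := by
  rw [integral_sub_right_eq_self (heatKernel t) x, integral_heatKernel ht]

theorem lintegral_heatKernel_sub {t : ℝ} (ht : 0 < t) (x : E d) :
    ∫⁻ y, ENNReal.ofReal (heatKernel t (y - x)) = 1 := by
  rw [lintegral_sub_right_eq_self (fun y => ENNReal.ofReal (heatKernel t y)) x,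
    lintegral_heatKernel ht]

/-- Take `u = e^k` on a null set `s` and `1` elsewhere. The semigroup does not see `s`, so `π_t u =
1` and the test value is `k α(s)` for every `k`. -/
theorem absolutelyContinuous_of_rateJ_ne_top {t : ℝ} (ht : 0 < t) {α : Measure (E d)}
    [IsFiniteMeasure α] (h : rateJ t α ≠ ⊤) : α ≪ volume := by
  classical
  refine Measure.AbsolutelyContinuous.mk fun s hs hs0 => ?_
  have key : ∀ k : ℕ, (k : ℝ) * α.real s ≤ (rateJ t α).toReal := by
    intro k
    let u : E d → ℝ := s.piecewise (fun _ => Real.exp k) (fun _ => 1)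
    have hk : 1 ≤ Real.exp k := Real.one_le_exp (Nat.cast_nonneg k)
    have hu : IsTestFun u := by
      refine ⟨measurable_const.piecewise hs measurable_const, 1, Real.exp k, one_pos,
        fun x => ?_⟩
      by_cases hx : x ∈ s <;> simp [u, hx]
    have hsg : ∀ x, heatSemigroup t u x = 1 := by
      intro x
      rw [heatSemigroup, ← integral_heatKernel_sub ht x]
      refine integral_congr_ae ?_
      filter_upwards [measure_eq_zero_iff_ae_notMem.1 hs0] with y hy
      simp [u, hy]
    have hlog : ∀ x, Real.log (heatSemigroup t u x / u x) = -s.indicator (fun _ => (k : ℝ)) x := by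
      intro x
      rw [hsg]
      by_cases hx : x ∈ s <;> simp [u, hx]
    have hle : ENNReal.ofReal (-∫ x, Real.log (heatSemigroup t u x / u x) ∂α) ≤ rateJ t α :=
      le_iSup₂ (f := fun (u : E d → ℝ) (_ : IsTestFun u) =>
        ENNReal.ofReal (-∫ x, Real.log (heatSemigroup t u x / u x) ∂α)) u hu
    simp_rw [hlog] at hle
    rw [integral_neg, neg_neg, integral_indicator_const _ hs, smul_eq_mul, mul_comm] at hle
    exact (ENNReal.ofReal_le_iff_le_toReal h).1 hle
  have h0 : α.real s = 0 := by
    by_contra hne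
    have hpos : 0 < α.real s := lt_of_le_of_ne measureReal_nonneg (Ne.symm hne)
    obtain ⟨k, hk⟩ := exists_nat_gt ((rateJ t α).toReal / α.real s)
    rw [div_lt_iff₀ hpos] at hk
    exact absurd (key k) (not_le.2 hk)
  exact (measureReal_eq_zero_iff).1 h0

theorem ofReal_heatSemigroup {t : ℝ} (ht : 0 < t) {u : E d → ℝ} (hu : IsTestFun u) (x : E d) :
    ENNReal.ofReal (heatSemigroup t u x) =
      ∫⁻ y, ENNReal.ofReal (heatKernel t (y - x)) * ENNReal.ofReal (u y) := by
  obtain ⟨hm, a, b, ha, hab⟩ := hu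
  have hint : Integrable fun y => heatKernel t (y - x) * u y := by
    refine ((integrable_heatKernel ht).comp_sub_right x).mul_bdd (c := b)
      hm.aestronglyMeasurable (.of_forall fun y => ?_)
    rw [Real.norm_of_nonneg (ha.le.trans (hab y).1)]
    exact (hab y).2
  rw [heatSemigroup, ofReal_integral_eq_lintegral_ofReal hint (.of_forall fun y =>
    mul_nonneg (heatKernel_nonneg ht _) (ha.le.trans (hab y).1))]
  exact lintegral_congr fun y => ENNReal.ofReal_mul (heatKernel_nonneg ht _)

theorem measurable_heatSemigroup {t : ℝ} {u : E d → ℝ} (hu : Measurable u) :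
    Measurable (heatSemigroup t u) := by
  have hk := measurable_heatKernel (d := d) t
  have : StronglyMeasurable (Function.uncurry fun x y : E d => heatKernel t (y - x) * u y) := by
    refine Measurable.stronglyMeasurable ?_
    unfold Function.uncurry
    fun_prop
  exact (StronglyMeasurable.integral_prod_right this).measurable

theorem heatSemigroup_mem_Icc {t : ℝ} (ht : 0 < t) {u : E d → ℝ} (hm : Measurable u) {a b : ℝ}
    (ha : 0 < a) (hab : ∀ x, a ≤ u x ∧ u x ≤ b) (x : E d) :
    a ≤ heatSemigroup t u x ∧ heatSemigroup t u x ≤ b := by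
  have hk := (integrable_heatKernel (d := d) ht).comp_sub_right x
  have hint : Integrable fun y => heatKernel t (y - x) * u y := by
    refine hk.mul_bdd (c := b) hm.aestronglyMeasurable (.of_forall fun y => ?_)
    rw [Real.norm_of_nonneg (ha.le.trans (hab y).1)]
    exact (hab y).2
  have hc : ∀ c : ℝ, ∫ y, heatKernel t (y - x) * c = c := fun c => by
    rw [integral_mul_const, integral_heatKernel_sub ht, one_mul]
  constructor
  · rw [← hc a]
    exact integral_mono (hk.mul_const a) hint fun y =>
      mul_le_mul_of_nonneg_left (hab y).1 (heatKernel_nonneg ht _)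
  · rw [← hc b]
    exact integral_mono hint (hk.mul_const b) fun y =>
      mul_le_mul_of_nonneg_left (hab y).2 (heatKernel_nonneg ht _)

/-- A lower bound of the rate function from `-log r ≥ 1 - r`. -/
theorem measure_univ_le_rateJ_add {t : ℝ} (ht : 0 < t) (α : Measure (E d)) [IsFiniteMeasure α]
    {u : E d → ℝ} (hu : IsTestFun u) :
    α Set.univ ≤ rateJ t α + ∫⁻ x, ENNReal.ofReal (heatSemigroup t u x / u x) ∂α := by
  have hle : ENNReal.ofReal (-∫ x, Real.log (heatSemigroup t u x / u x) ∂α) ≤ rateJ t α :=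
    le_iSup₂ (f := fun (u : E d → ℝ) (_ : IsTestFun u) =>
      ENNReal.ofReal (-∫ x, Real.log (heatSemigroup t u x / u x) ∂α)) u hu
  obtain ⟨hm, a, b, ha, hab⟩ := hu
  have hS := heatSemigroup_mem_Icc ht hm ha hab
  have hb : 0 < b := ha.trans_le ((hab 0).1.trans (hab 0).2)
  -- Two-sided bounds on the ratio make it and its logarithm integrable, so the Bochner integrals
  -- below are not default zeros.
  have hlo : ∀ x, a / b ≤ heatSemigroup t u x / u x := fun x =>
    div_le_div₀ (ha.le.trans (hS x).1) (hS x).1 (ha.trans_le (hab x).1) (hab x).2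
  have hhi : ∀ x, heatSemigroup t u x / u x ≤ b / a := fun x =>
    div_le_div₀ hb.le (hS x).2 ha (hab x).1
  have hpos : ∀ x, 0 < heatSemigroup t u x / u x := fun x => (div_pos ha hb).trans_le (hlo x)
  have hrm : Measurable fun x => heatSemigroup t u x / u x := (measurable_heatSemigroup hm).div hm
  have hr : Integrable (fun x => heatSemigroup t u x / u x) α := by
    refine Integrable.of_bound hrm.aestronglyMeasurable (b / a) (.of_forall fun x => ?_)
    rw [Real.norm_of_nonneg (hpos x).le]
    exact hhi x
  have hlog : Integrable (fun x => Real.log (heatSemigroup t u x / u x)) α := by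
    refine Integrable.of_bound (Real.measurable_log.comp hrm).aestronglyMeasurable
      (max |Real.log (a / b)| |Real.log (b / a)|) (.of_forall fun x => ?_)
    exact abs_le_max_abs_abs (Real.log_le_log (div_pos ha hb) (hlo x))
      (Real.log_le_log (hpos x) (hhi x))
  have hmono : ∫ x, Real.log (heatSemigroup t u x / u x) ∂α ≤
      ∫ x, (heatSemigroup t u x / u x - 1) ∂α :=
    integral_mono hlog (hr.sub (integrable_const 1)) fun x =>
      Real.log_le_sub_one_of_pos (hpos x)
  rw [integral_sub hr (integrable_const 1), integral_const, smul_eq_mul, mul_one] at hmono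
  rw [← ofReal_integral_eq_lintegral_ofReal hr (.of_forall fun x => (hpos x).le),
    ← ofReal_measureReal]
  refine (ENNReal.ofReal_le_ofReal (q := -(∫ x, Real.log (heatSemigroup t u x / u x) ∂α) +
    ∫ x, heatSemigroup t u x / u x ∂α) (by linarith)).trans ?_
  exact ENNReal.ofReal_add_le.trans (add_le_add hle le_rfl)

/-- The error in replacing the test function `φ` by `min φ (n + 1) + 1 / (n + 1)`. -/
noncomputable def truncError (n : ℕ) (a : ℝ) : ℝ :=
  a ^ 2 * ((if (n : ℝ) + 1 < a then 1 else 0) +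
    (1 / ((n : ℝ) + 1)) / (min a (n + 1) + 1 / ((n : ℝ) + 1)))

theorem truncError_le {a : ℝ} (ha : 0 ≤ a) (n : ℕ) : truncError n a ≤ 2 * a ^ 2 := by
  have h1 : (if (n : ℝ) + 1 < a then (1 : ℝ) else 0) ≤ 1 := by split_ifs <;> norm_num
  have h3 : 0 ≤ min a ((n : ℝ) + 1) := le_min ha (by positivity)
  have h2 : (1 / ((n : ℝ) + 1)) / (min a (n + 1) + 1 / ((n : ℝ) + 1)) ≤ 1 :=
    div_le_one_of_le₀ (by linarith) (by positivity)
  unfold truncError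
  nlinarith [sq_nonneg a]

theorem tendsto_truncError {a : ℝ} (ha : 0 ≤ a) :
    Tendsto (fun n => truncError n a) atTop (𝓝 0) := by
  -- At `a = 0` the fraction in the error equals `1` for every `n`; only the factor `a²` removes it.
  rcases ha.eq_or_lt with rfl | ha
  · simp [truncError]
  have hlim : Tendsto (fun n : ℕ => a ^ 2 * ((1 / ((n : ℝ) + 1)) / (a + 1 / ((n : ℝ) + 1))))
      atTop (𝓝 (a ^ 2 * (0 / (a + 0)))) :=
    (tendsto_one_div_add_atTop_nhds_zero_nat.div
      (tendsto_const_nhds.add tendsto_one_div_add_atTop_nhds_zero_nat) (by simpa using ha.ne')).const_mul _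
  rw [zero_div, mul_zero] at hlim
  refine hlim.congr' ?_
  obtain ⟨N, hN⟩ := exists_nat_gt a
  filter_upwards [eventually_ge_atTop N] with n hn
  have hn' : (N : ℝ) ≤ n := by exact_mod_cast hn
  have : a ≤ (n : ℝ) + 1 := by linarith
  simp [truncError, this]

theorem measurable_truncError (n : ℕ) : Measurable (truncError n) := by
  unfold truncError
  have : Measurable fun a : ℝ => if (n : ℝ) + 1 < a then (1 : ℝ) else 0 :=
    Measurable.ite measurableSet_Ioi measurable_const measurable_const
  fun_prop

theorem trunc_isTestFun {φ : E d → ℝ} (hφ : Measurable φ) (h0 : ∀ x, 0 ≤ φ x) (n : ℕ) :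
    IsTestFun fun x => min (φ x) (n + 1) + 1 / ((n : ℝ) + 1) := by
  refine ⟨by fun_prop, 1 / ((n : ℝ) + 1), (n + 1) + 1 / ((n : ℝ) + 1), by positivity,
    fun x => ⟨?_, ?_⟩⟩
  · have : 0 ≤ min (φ x) ((n : ℝ) + 1) := le_min (h0 x) (by positivity)
    linarith
  · exact add_le_add (min_le_right _ _) le_rfl

/-- Write `v` for the truncated test function at `x`. Where `φ x ≤ n + 1`, `v ≥ φ x` gives `φ²/v ≤
φ`. Where `φ x > n + 1`, the semigroup applied to `min φ (n + 1)` is at most `n + 1 ≤ v`, which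
costs `φ²`. The added constant `1 / (n + 1)` accounts for the rest of the error. -/
theorem sq_mul_heatSemigroup_trunc_le {t : ℝ} (ht : 0 < t) {φ : E d → ℝ} (hφ : Measurable φ)
    (h0 : ∀ x, 0 ≤ φ x) (n : ℕ) (x : E d) :
    ENNReal.ofReal (φ x ^ 2) * ENNReal.ofReal
        (heatSemigroup t (fun x => min (φ x) (n + 1) + 1 / ((n : ℝ) + 1)) x /
          (min (φ x) (n + 1) + 1 / ((n : ℝ) + 1))) ≤
      ENNReal.ofReal (φ x) * (∫⁻ y, ENNReal.ofReal (heatKernel t (y - x)) * ENNReal.ofReal (φ y)) +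
        ENNReal.ofReal (truncError n (φ x)) := by
  have hk := measurable_heatKernel (d := d) t
  set η : ℝ := 1 / ((n : ℝ) + 1) with hη
  have hη0 : 0 < η := by positivity
  have hN0 : (0 : ℝ) < (n : ℝ) + 1 := by positivity
  set P : ℝ≥0∞ := ∫⁻ y, ENNReal.ofReal (heatKernel t (y - x)) *
    ENNReal.ofReal (min (φ y) (n + 1)) with hP
  have hmin : ∀ y, 0 ≤ min (φ y) ((n : ℝ) + 1) := fun y => le_min (h0 y) hN0.le
  have hsplit : ENNReal.ofReal (heatSemigroup t (fun x => min (φ x) (n + 1) + η) x) =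
      P + ENNReal.ofReal η := by
    rw [ofReal_heatSemigroup ht (trunc_isTestFun hφ h0 n)]
    simp_rw [← hη, ENNReal.ofReal_add (hmin _) hη0.le, mul_add]
    rw [lintegral_add_left (by fun_prop), lintegral_mul_const _ (by fun_prop),
      lintegral_heatKernel_sub ht, one_mul]
  have hP1 : P ≤ ∫⁻ y, ENNReal.ofReal (heatKernel t (y - x)) * ENNReal.ofReal (φ y) :=
    lintegral_mono fun y => by gcongr; exact min_le_left _ _
  have hP2 : P ≤ ENNReal.ofReal ((n : ℝ) + 1) := by
    calc P ≤ ∫⁻ y, ENNReal.ofReal (heatKernel t (y - x)) * ENNReal.ofReal ((n : ℝ) + 1) :=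
          lintegral_mono fun y => by gcongr; exact min_le_right _ _
      _ = _ := by
          rw [lintegral_mul_const _ (by fun_prop), lintegral_heatKernel_sub ht, one_mul]
  have hu0 : 0 < min (φ x) ((n : ℝ) + 1) + η := by linarith [hmin x]
  set v : ℝ := min (φ x) ((n : ℝ) + 1) + η with hv
  have hlhs : ENNReal.ofReal (φ x ^ 2) * ENNReal.ofReal
      (heatSemigroup t (fun x => min (φ x) (n + 1) + η) x / v) =
      ENNReal.ofReal (φ x ^ 2 / v) * P + ENNReal.ofReal (φ x ^ 2 * (η / v)) := by
    rw [div_eq_inv_mul, ENNReal.ofReal_mul (by positivity), hsplit, ← mul_assoc,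
      ← ENNReal.ofReal_mul (by positivity), ← div_eq_mul_inv, mul_add,
      ← ENNReal.ofReal_mul (by positivity)]
    congr 2
    ring
  rw [hlhs, truncError, ← hη, ← hv, mul_add, ENNReal.ofReal_add (by positivity) (by positivity),
    ← add_assoc]
  gcongr
  split_ifs with hx
  · have : ENNReal.ofReal (φ x ^ 2 / v) * P ≤ ENNReal.ofReal (φ x ^ 2 * 1) := by
      refine (mul_le_mul_right hP2 _).trans ?_
      rw [← ENNReal.ofReal_mul (by positivity)]
      refine ENNReal.ofReal_le_ofReal ?_
      rw [div_mul_eq_mul_div, mul_one, div_le_iff₀ hu0]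
      gcongr
      rw [hv, min_eq_right hx.le]
      linarith
    exact this.trans le_add_self
  · refine le_add_right ?_
    refine mul_le_mul' (ENNReal.ofReal_le_ofReal ?_) hP1
    rw [div_le_iff₀ hu0, hv, min_eq_left (not_lt.1 hx)]
    nlinarith [h0 x]

/-- `‖φ‖² - ⟨φ, π_t φ⟩ ≤ J_t(φ² dx)`. -/
theorem lintegral_sq_le_rateJ_add {t : ℝ} (ht : 0 < t) {φ : E d → ℝ} (hφ : Measurable φ)
    (h0 : ∀ x, 0 ≤ φ x) (hfin : ∫⁻ x, ENNReal.ofReal (φ x ^ 2) ≠ ⊤) :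
    ∫⁻ x, ENNReal.ofReal (φ x ^ 2) ≤
      rateJ t (volume.withDensity fun x => ENNReal.ofReal (φ x ^ 2)) +
      ∫⁻ x, ENNReal.ofReal (φ x) *
        ∫⁻ y, ENNReal.ofReal (heatKernel t (y - x)) * ENNReal.ofReal (φ y) := by
  have hk := measurable_heatKernel (d := d) t
  have hdm : Measurable fun x => ENNReal.ofReal (φ x ^ 2) := by fun_prop
  set α : Measure (E d) := volume.withDensity fun x => ENNReal.ofReal (φ x ^ 2) with hα
  have : IsFiniteMeasure α := isFiniteMeasure_withDensity hfin
  have hmass : α Set.univ = ∫⁻ x, ENNReal.ofReal (φ x ^ 2) := by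
    rw [hα, withDensity_apply _ MeasurableSet.univ, Measure.restrict_univ]
  -- The function `φ` need not be admissible itself; the truncation error vanishes by dominated
  -- convergence with majorant `2 φ²`.
  have herr : Tendsto (fun n : ℕ => ∫⁻ x, ENNReal.ofReal (truncError n (φ x))) atTop (𝓝 0) := by
    have h := tendsto_lintegral_of_dominated_convergence (μ := (volume : Measure (E d)))
      (F := fun n x => ENNReal.ofReal (truncError n (φ x))) (f := fun _ => 0)
      (fun x => 2 * ENNReal.ofReal (φ x ^ 2))
      (fun n => ((measurable_truncError n).comp hφ).ennreal_ofReal)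
      (fun n => .of_forall fun x => ?_)
      (by rw [lintegral_const_mul _ hdm]; exact ENNReal.mul_ne_top ENNReal.ofNat_ne_top hfin)
      (.of_forall fun x => ?_)
    · simpa using h
    · refine (ENNReal.ofReal_le_ofReal (truncError_le (h0 x) n)).trans (le_of_eq ?_)
      rw [ENNReal.ofReal_mul zero_le_two, ENNReal.ofReal_ofNat]
    · simpa using ENNReal.tendsto_ofReal (tendsto_truncError (h0 x))
  have hstep : ∀ n : ℕ, ∫⁻ x, ENNReal.ofReal (φ x ^ 2) ≤ (rateJ t α +
      ∫⁻ x, ENNReal.ofReal (φ x) *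
        ∫⁻ y, ENNReal.ofReal (heatKernel t (y - x)) * ENNReal.ofReal (φ y)) +
      ∫⁻ x, ENNReal.ofReal (truncError n (φ x)) := by
    intro n
    have hu := trunc_isTestFun hφ h0 n
    have h := measure_univ_le_rateJ_add ht α hu
    have hrm : Measurable fun x => ENNReal.ofReal
        (heatSemigroup t (fun x => min (φ x) (n + 1) + 1 / ((n : ℝ) + 1)) x /
          (min (φ x) (n + 1) + 1 / ((n : ℝ) + 1))) :=
      ((measurable_heatSemigroup hu.1).div hu.1).ennreal_ofReal
    rw [hmass, hα, lintegral_withDensity_eq_lintegral_mul _ hdm hrm] at h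
    refine h.trans ?_
    rw [add_assoc]
    gcongr
    have hem : Measurable fun x => ENNReal.ofReal (truncError n (φ x)) :=
      ((measurable_truncError n).comp hφ).ennreal_ofReal
    rw [← lintegral_add_right _ hem]
    exact lintegral_mono fun x => sq_mul_heatSemigroup_trunc_le ht hφ h0 n x
  have hlim := herr.const_add (rateJ t α + ∫⁻ x, ENNReal.ofReal (φ x) *
        ∫⁻ y, ENNReal.ofReal (heatKernel t (y - x)) * ENNReal.ofReal (φ y))
  rw [add_zero] at hlim
  exact ge_of_tendsto' hlim hstep

/-- The Dirichlet form `⟨φ, (1 - π_t) φ⟩` is bounded by the rate function. -/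
theorem lintegral_heatKernel_sqIncr_le_rateJ {t : ℝ} (ht : 0 < t) {φ : E d → ℝ}
    (hφ : Measurable φ) (h0 : ∀ x, 0 ≤ φ x) (hfin : ∫⁻ x, ENNReal.ofReal (φ x ^ 2) ≠ ⊤) :
    ∫⁻ z, ENNReal.ofReal (heatKernel t z) * sqIncr φ z ≤
      2 * rateJ t (volume.withDensity fun x => ENNReal.ofReal (φ x ^ 2)) := by
  have hk := measurable_heatKernel (d := d) t
  have hsm := measurable_sqIncr hφ
  set m : ℝ≥0∞ := ∫⁻ x, ENNReal.ofReal (φ x ^ 2) with hm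
  set C : ℝ≥0∞ := ∫⁻ x, ENNReal.ofReal (φ x) *
        ∫⁻ y, ENNReal.ofReal (heatKernel t (y - x)) * ENNReal.ofReal (φ y) with hC
  have hle := lintegral_sq_le_rateJ_add ht hφ h0 hfin
  have hC2 : C = ∫⁻ z, ENNReal.ofReal (heatKernel t z) *
      ∫⁻ x, ENNReal.ofReal (φ (x + z)) * ENNReal.ofReal (φ x) := by
    calc C = ∫⁻ x, ∫⁻ z, ENNReal.ofReal (heatKernel t z) *
          (ENNReal.ofReal (φ (x + z)) * ENNReal.ofReal (φ x)) := by
          refine lintegral_congr fun x => ?_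
          rw [← lintegral_const_mul' _ _ ENNReal.ofReal_ne_top,
            ← lintegral_add_right_eq_self _ x]
          refine lintegral_congr fun z => ?_
          rw [add_sub_cancel_right, add_comm z x]
          ring
      _ = ∫⁻ z, ∫⁻ x, ENNReal.ofReal (heatKernel t z) *
          (ENNReal.ofReal (φ (x + z)) * ENNReal.ofReal (φ x)) :=
          lintegral_lintegral_swap (by unfold Function.uncurry; fun_prop)
      _ = _ := lintegral_congr fun z => lintegral_const_mul' _ _ ENNReal.ofReal_ne_top
  -- Expansion of the square, with the cross term moved to the left so that no subtraction occurs.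
  have hz : ∀ z, sqIncr φ z + 2 * ∫⁻ x, ENNReal.ofReal (φ (x + z)) * ENNReal.ofReal (φ x) =
      2 * m := by
    intro z
    have hsh := lintegral_add_right_eq_self (μ := (volume : Measure (E d)))
      (fun x => ENNReal.ofReal (φ x ^ 2)) z
    rw [sqIncr, ← lintegral_const_mul _ (by fun_prop), ← lintegral_add_left (by fun_prop), two_mul]
    nth_rewrite 1 [hm]
    rw [← hsh, hm, ← lintegral_add_left (by fun_prop)]
    refine lintegral_congr fun x => ?_
    rw [← ENNReal.ofReal_mul (h0 _), two_mul,
      ← ENNReal.ofReal_add (mul_nonneg (h0 _) (h0 _)) (mul_nonneg (h0 _) (h0 _)), ← ENNReal.ofReal_add (sq_nonneg _)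
        (add_nonneg (mul_nonneg (h0 _) (h0 _)) (mul_nonneg (h0 _) (h0 _))),
      ← ENNReal.ofReal_add (sq_nonneg _) (sq_nonneg _)]
    congr 1
    ring
  have hsum : (∫⁻ z, ENNReal.ofReal (heatKernel t z) * sqIncr φ z) + 2 * C = 2 * m := by
    rw [hC2, ← lintegral_const_mul' _ _ ENNReal.ofNat_ne_top, ← lintegral_add_left (by fun_prop)]
    calc _ = ∫⁻ z : E d, ENNReal.ofReal (heatKernel t z) * (2 * m) := by
          refine lintegral_congr fun z => ?_
          rw [← hz z]
          ring
      _ = _ := by rw [lintegral_mul_const _ (by fun_prop), lintegral_heatKernel ht, one_mul]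
  -- The form plus `2 C` equals `2 m ≤ 2 J + 2 C`; cancelling `2 C` requires it to be finite.
  have hCfin : 2 * C ≠ ⊤ :=
    ne_top_of_le_ne_top (ENNReal.mul_ne_top ENNReal.ofNat_ne_top hfin) (hsum ▸ le_add_self)
  refine (ENNReal.add_le_add_iff_right hCfin).1 ?_
  rw [hsum, ← mul_add]
  gcongr

/-! ### Smoothing -/

theorem measurable_oneSubExpNeg : Measurable oneSubExpNeg := by
  unfold oneSubExpNeg
  exact Measurable.ite (measurableSet_singleton ⊤) measurable_const (by fun_prop)

theorem oneSubExpNeg_le_one (a : ℝ≥0∞) : oneSubExpNeg a ≤ 1 := by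
  unfold oneSubExpNeg
  split_ifs
  · exact le_rfl
  · refine ENNReal.ofReal_le_one.2 ?_
    linarith [Real.exp_pos (-a.toReal)]

/-- Monotonicity and the 1-Lipschitz bound in one additive inequality: `e^{-a} ≥ e^{-b} e^{-c} ≥
e^{-b} (1 - c) ≥ e^{-b} - c`. -/
theorem oneSubExpNeg_le_add {a b c : ℝ≥0∞} (h : a ≤ b + c) :
    oneSubExpNeg a ≤ oneSubExpNeg b + c := by
  rcases eq_or_ne c ⊤ with rfl | hc
  · simp
  rcases eq_or_ne b ⊤ with rfl | hb
  · refine (oneSubExpNeg_le_one a).trans (le_add_right ?_)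
    simp [oneSubExpNeg]
  have ha : a ≠ ⊤ := ne_top_of_le_ne_top (ENNReal.add_ne_top.2 ⟨hb, hc⟩) h
  have h' : a.toReal ≤ b.toReal + c.toReal := by
    rw [← ENNReal.toReal_add hb hc]
    exact ENNReal.toReal_mono (ENNReal.add_ne_top.2 ⟨hb, hc⟩) h
  have hc0 : 0 ≤ c.toReal := ENNReal.toReal_nonneg
  have hb0 : 0 ≤ b.toReal := ENNReal.toReal_nonneg
  have hb1 : Real.exp (-b.toReal) ≤ 1 := Real.exp_le_one_iff.2 (by linarith)
  rw [oneSubExpNeg, if_neg ha, oneSubExpNeg, if_neg hb]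
  conv_rhs => rw [← ENNReal.ofReal_toReal hc]
  rw [← ENNReal.ofReal_add (by linarith) hc0]
  refine ENNReal.ofReal_le_ofReal ?_
  have h1 : Real.exp (-b.toReal) * Real.exp (-c.toReal) ≤ Real.exp (-a.toReal) := by
    rw [← Real.exp_add]
    exact Real.exp_le_exp.2 (by linarith)
  have h2 := Real.one_sub_le_exp_neg c.toReal
  nlinarith [Real.exp_pos (-b.toReal)]

theorem oneSubExpNeg_le_self (a : ℝ≥0∞) : oneSubExpNeg a ≤ a := by
  have h := oneSubExpNeg_le_add (a := a) (b := 0) (c := a) (by simp)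
  simpa [oneSubExpNeg] using h

/-- `∫ (1 - e^{-κ (q * α)(x)}) dx`. -/
noncomputable def smoothedGam (κ : ℝ) (q : E d → ℝ≥0∞) (α : Measure (E d)) : ℝ≥0∞ :=
  ∫⁻ x, oneSubExpNeg (ENNReal.ofReal κ * ∫⁻ y, q (x - y) ∂α)

section Smoothing

variable {φ : E d → ℝ} {q : E d → ℝ≥0∞} (κ : ℝ)

theorem lintegral_kernel_withDensity (hφ : Measurable φ) (hq : Measurable q) (x : E d) :
    ∫⁻ y, q (x - y) ∂(volume.withDensity fun x => ENNReal.ofReal (φ x ^ 2)) =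
      ∫⁻ z, q z * ENNReal.ofReal (φ (x - z) ^ 2) := by
  have hdm : Measurable fun x => ENNReal.ofReal (φ x ^ 2) := by fun_prop
  have hqm : Measurable fun y => q (x - y) := by fun_prop
  rw [lintegral_withDensity_eq_lintegral_mul _ hdm hqm,
    ← lintegral_sub_left_eq_self (fun z => q z * ENNReal.ofReal (φ (x - z) ^ 2)) x]
  refine lintegral_congr fun y => ?_
  simp only [Pi.mul_apply, sub_sub_cancel, mul_comm]

theorem lintegral_lintegral_kernel_abs (hφ : Measurable φ) (hq : Measurable q) :
    ∫⁻ x, ∫⁻ z, q z * ENNReal.ofReal |φ x ^ 2 - φ (x - z) ^ 2| =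
      ∫⁻ z, q z * absIncr φ z := by
  rw [lintegral_lintegral_swap (by unfold Function.uncurry; fun_prop)]
  refine lintegral_congr fun z => ?_
  rw [lintegral_const_mul _ (by fun_prop), absIncr,
    ← lintegral_add_right_eq_self (fun x => ENNReal.ofReal |φ x ^ 2 - φ (x - z) ^ 2|) z]
  simp only [add_sub_cancel_right]

theorem ofReal_le_ofReal_add_abs_sub (a b : ℝ) :
    ENNReal.ofReal a ≤ ENNReal.ofReal b + ENNReal.ofReal |a - b| :=
  (ENNReal.ofReal_le_ofReal (by linarith [le_abs_self (a - b)])).trans ENNReal.ofReal_add_le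

/-- As `q` has mass one, `φ² - q * φ²` is a `q`-average of increments of `φ²`. This and the reverse
inequality below replace an absolute value in `ℝ≥0∞`. -/
theorem lintegral_oneSubExpNeg_le_smoothedGam_add (hφ : Measurable φ) (hq : Measurable q)
    (hq1 : ∫⁻ z, q z = 1) :
    ∫⁻ x, oneSubExpNeg (ENNReal.ofReal κ * ENNReal.ofReal (φ x ^ 2)) ≤
      smoothedGam κ q (volume.withDensity fun x => ENNReal.ofReal (φ x ^ 2)) +
        ENNReal.ofReal κ * ∫⁻ z, q z * absIncr φ z := by
  have hem : Measurable fun x => ∫⁻ z, q z * ENNReal.ofReal |φ x ^ 2 - φ (x - z) ^ 2| :=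
    Measurable.lintegral_prod_right (f := fun x z : E d =>
      q z * ENNReal.ofReal |φ x ^ 2 - φ (x - z) ^ 2|) (by unfold Function.uncurry; fun_prop)
  rw [smoothedGam, ← lintegral_lintegral_kernel_abs hφ hq,
    ← lintegral_const_mul' _ _ ENNReal.ofReal_ne_top, ← lintegral_add_right _ (hem.const_mul _)]
  refine lintegral_mono fun x => oneSubExpNeg_le_add ?_
  rw [lintegral_kernel_withDensity hφ hq, ← mul_add, ← lintegral_add_left (by fun_prop)]
  gcongr
  calc ENNReal.ofReal (φ x ^ 2) = ∫⁻ z, q z * ENNReal.ofReal (φ x ^ 2) := by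
        rw [lintegral_mul_const _ hq, hq1, one_mul]
    _ ≤ _ := by
        refine lintegral_mono fun z => ?_
        rw [← mul_add]
        gcongr
        exact ofReal_le_ofReal_add_abs_sub _ _

theorem smoothedGam_le_lintegral_oneSubExpNeg_add (hφ : Measurable φ) (hq : Measurable q)
    (hq1 : ∫⁻ z, q z = 1) :
    smoothedGam κ q (volume.withDensity fun x => ENNReal.ofReal (φ x ^ 2)) ≤
      (∫⁻ x, oneSubExpNeg (ENNReal.ofReal κ * ENNReal.ofReal (φ x ^ 2))) +
        ENNReal.ofReal κ * ∫⁻ z, q z * absIncr φ z := by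
  have hdm : Measurable fun x => oneSubExpNeg (ENNReal.ofReal κ * ENNReal.ofReal (φ x ^ 2)) :=
    measurable_oneSubExpNeg.comp (by fun_prop)
  rw [smoothedGam, ← lintegral_lintegral_kernel_abs hφ hq,
    ← lintegral_const_mul' _ _ ENNReal.ofReal_ne_top, ← lintegral_add_left hdm]
  refine lintegral_mono fun x => oneSubExpNeg_le_add ?_
  rw [lintegral_kernel_withDensity hφ hq, ← mul_add]
  gcongr
  calc ∫⁻ z, q z * ENNReal.ofReal (φ (x - z) ^ 2)
      ≤ ∫⁻ z, (q z * ENNReal.ofReal (φ x ^ 2) +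
          q z * ENNReal.ofReal |φ x ^ 2 - φ (x - z) ^ 2|) := by
        refine lintegral_mono fun z => ?_
        rw [← mul_add, abs_sub_comm]
        gcongr
        exact ofReal_le_ofReal_add_abs_sub _ _
    _ = _ := by
        rw [lintegral_add_left (by fun_prop), lintegral_mul_const _ hq, hq1, one_mul]

end Smoothing

/-! ### The kernel of `Ψ_ε` -/

/-- `(1/ε) ∫_0^r p_{s/d}(z) ds`. -/
noncomputable def timeAvgKernel (ε r : ℝ) (z : E d) : ℝ≥0∞ :=
  ENNReal.ofReal (1 / ε) * ∫⁻ s in Set.Ioc (0 : ℝ) r, ENNReal.ofReal (heatKernel (s / d) z)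

theorem measurable_heatKernel_div : Measurable fun p : ℝ × E d => heatKernel (p.1 / d) p.2 :=
  measurable_heatKernel_uncurry.comp
    ((measurable_fst.div_const (d : ℝ)).prodMk measurable_snd)

theorem measurable_timeAvgKernel (ε r : ℝ) : Measurable (timeAvgKernel ε r : E d → ℝ≥0∞) := by
  unfold timeAvgKernel
  refine Measurable.const_mul (Measurable.lintegral_prod_right (f := fun (z : E d) (s : ℝ) =>
    ENNReal.ofReal (heatKernel (s / d) z)) ?_) _
  exact (measurable_heatKernel_div.comp measurable_swap).ennreal_ofReal

theorem lintegral_timeAvgKernel (hd : 0 < d) {ε r : ℝ} (hε : 0 < ε) :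
    ∫⁻ z : E d, timeAvgKernel ε r z = ENNReal.ofReal (r / ε) := by
  have hd' : (0 : ℝ) < d := by exact_mod_cast hd
  unfold timeAvgKernel
  rw [lintegral_const_mul' _ _ ENNReal.ofReal_ne_top, lintegral_lintegral_swap
    (measurable_heatKernel_div.comp measurable_swap).ennreal_ofReal.aemeasurable,
    setLIntegral_congr_fun (g := fun _ => 1) measurableSet_Ioc
      (fun s hs => lintegral_heatKernel (div_pos hs.1 hd')),
    setLIntegral_one, Real.volume_Ioc, sub_zero, ← ENNReal.ofReal_mul (by positivity)]
  congr 1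
  ring

theorem Psi_eq_smoothedGam {κ ε : ℝ} (hκ : 0 < κ) (α : Measure (E d)) [SFinite α] :
    Psi κ ε α = smoothedGam κ (timeAvgKernel ε ε) α := by
  refine lintegral_congr fun x => ?_
  congr 1
  simp only [timeAvgKernel, heatConv]
  rw [lintegral_const_mul' _ _ ENNReal.ofReal_ne_top, ← mul_assoc, ← ENNReal.ofReal_mul hκ.le,
    mul_one_div, lintegral_lintegral_swap]
  exact (measurable_heatKernel_div.comp (measurable_fst.prodMk
    (measurable_const.sub measurable_snd))).ennreal_ofReal.aemeasurable

/-- Split the average at time `η ε`. Later times have `ε / s ≤ 1 / η`, so `heatKernel_le` compares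
their kernel with that at time `ε / d`, and their total weight is at most one. -/
theorem timeAvgKernel_le (hd : 0 < d) {ε η : ℝ} (hε : 0 < ε) (hη : 0 < η) (hη1 : η ≤ 1)
    (z : E d) :
    timeAvgKernel ε ε z ≤ timeAvgKernel ε (η * ε) z +
      ENNReal.ofReal ((1 / η) ^ ((d : ℝ) / 2)) * ENNReal.ofReal (heatKernel (ε / d) z) := by
  have hd' : (0 : ℝ) < d := by exact_mod_cast hd
  have hηε : η * ε ≤ ε := mul_le_of_le_one_left hε.le hη1
  unfold timeAvgKernel
  rw [← Set.Ioc_union_Ioc_eq_Ioc (by positivity : 0 ≤ η * ε) hηε,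
    lintegral_union measurableSet_Ioc (Set.Ioc_disjoint_Ioc_of_le le_rfl), mul_add]
  refine add_le_add le_rfl ?_
  have hb : ∫⁻ s in Set.Ioc (η * ε) ε, ENNReal.ofReal (heatKernel (s / d) z) ≤
      ∫⁻ s in Set.Ioc (η * ε) ε, ENNReal.ofReal ((1 / η) ^ ((d : ℝ) / 2)) *
        ENNReal.ofReal (heatKernel (ε / d) z) := by
    refine setLIntegral_mono measurable_const fun s hs => ?_
    have hs0 : 0 < s := lt_trans (by positivity) hs.1
    rw [← ENNReal.ofReal_mul (by positivity)]
    refine ENNReal.ofReal_le_ofReal ((heatKernel_le (div_pos hs0 hd')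
      (div_le_div_of_nonneg_right hs.2 hd'.le) z).trans ?_)
    have := heatKernel_nonneg (div_pos hε hd') z
    refine mul_le_mul_of_nonneg_right (Real.rpow_le_rpow (by positivity) ?_ (by positivity)) this
    rw [div_div_div_cancel_right₀ hd'.ne', div_le_div_iff₀ hs0 hη]
    linarith [hs.1, mul_comm η ε]
  refine (mul_le_mul_right hb _).trans ?_
  rw [setLIntegral_const, Real.volume_Ioc, mul_left_comm]
  refine mul_le_of_le_one_right' ?_
  rw [← ENNReal.ofReal_mul (by positivity)]
  refine ENNReal.ofReal_le_one.2 ?_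
  rw [one_div, inv_mul_le_iff₀ hε]
  nlinarith

/-! ### Estimates for a single measure -/

theorem exists_sqrt_density {α : Measure (E d)} [IsFiniteMeasure α] (h : α ≪ volume) :
    ∃ φ : E d → ℝ, Measurable φ ∧ (∀ x, 0 ≤ φ x) ∧
      α = volume.withDensity fun x => ENNReal.ofReal (φ x ^ 2) := by
  refine ⟨fun x => √(α.rnDeriv volume x).toReal, ?_, fun x => Real.sqrt_nonneg _, ?_⟩
  · exact (Measure.measurable_rnDeriv α volume).ennreal_toReal.sqrt
  · conv_lhs => rw [← Measure.withDensity_rnDeriv_eq α volume h]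
    refine withDensity_congr_ae ?_
    filter_upwards [Measure.rnDeriv_lt_top α volume] with x hx
    rw [Real.sq_sqrt ENNReal.toReal_nonneg, ENNReal.ofReal_toReal hx.ne]

theorem Gam_withDensity (κ : ℝ) {φ : E d → ℝ} (hφ : Measurable φ) :
    Gam κ (volume.withDensity fun x => ENNReal.ofReal (φ x ^ 2)) =
      ∫⁻ x, oneSubExpNeg (ENNReal.ofReal κ * ENNReal.ofReal (φ x ^ 2)) := by
  rw [Gam, if_pos (withDensity_absolutelyContinuous _ _)]
  refine lintegral_congr_ae ?_
  filter_upwards [Measure.rnDeriv_withDensity volume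
    (show Measurable fun x => ENNReal.ofReal (φ x ^ 2) by fun_prop)] with x hx
  rw [hx]

/-- Needed for the finiteness of `Γ̃`, without which `absDiff` is infinite. -/
theorem Gam_le {α : Measure (E d)} [IsFiniteMeasure α] (κ : ℝ) (h : α ≪ volume) :
    Gam κ α ≤ ENNReal.ofReal κ * α Set.univ := by
  obtain ⟨φ, hφ, -, rfl⟩ := exists_sqrt_density h
  rw [Gam_withDensity κ hφ, withDensity_apply _ MeasurableSet.univ, Measure.restrict_univ,
    ← lintegral_const_mul' _ _ ENNReal.ofReal_ne_top]
  exact lintegral_mono fun x => oneSubExpNeg_le_self _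

/-- The bound of the `L¹` distance of `φ²` and its heat flow at time `δ / d`, in terms of the
rate `J` at time `ε / d` and the mass `m`. -/
noncomputable def smoothBound (d : ℕ) (ε δ : ℝ) (J m : ℝ≥0∞) : ℝ≥0∞ :=
  ENNReal.ofReal ((4 : ℝ) ^ ((d : ℝ) / 2) * 4 * √δ / ε) * J + ENNReal.ofReal (2 * √δ) * m

/-- The form at time `δ / d` is of order `δ J / ε`. When `J / ε` and `m` are of order one, the terms
`l δ` and `1 / l` of `absIncr_le` balance at `l = 1 / √δ`. -/
theorem lintegral_heatKernel_absIncr_le (hd : 0 < d) {ε δ : ℝ} (hε : 0 < ε) (hδ : ε ≤ δ)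
    {φ : E d → ℝ} (hφ : Measurable φ) (h0 : ∀ x, 0 ≤ φ x)
    (hfin : ∫⁻ x, ENNReal.ofReal (φ x ^ 2) ≠ ⊤) :
    ∫⁻ z, ENNReal.ofReal (heatKernel (δ / d) z) * absIncr φ z ≤
      smoothBound d ε δ (rateJ (ε / d) (volume.withDensity fun x => ENNReal.ofReal (φ x ^ 2)))
        (∫⁻ x, ENNReal.ofReal (φ x ^ 2)) := by
  have hd' : (0 : ℝ) < d := by exact_mod_cast hd
  have hδ0 := hε.trans_le hδ
  have hsd : 0 < √δ := Real.sqrt_pos.2 hδ0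
  have hk := measurable_heatKernel (d := d) (δ / d)
  have hsm := measurable_sqIncr hφ
  set m := ∫⁻ x, ENNReal.ofReal (φ x ^ 2) with hm
  set J := rateJ (ε / d) (volume.withDensity fun x => ENNReal.ofReal (φ x ^ 2)) with hJ
  set A : ℝ := (4 : ℝ) ^ ((d : ℝ) / 2) * 4 with hA
  have hA0 : 0 < A := by positivity
  have hdir : ∫⁻ z, ENNReal.ofReal (heatKernel (δ / d) z) * sqIncr φ z ≤
      ENNReal.ofReal (A * (δ / ε)) * (2 * J) := by
    refine (lintegral_heatKernel_sqIncr_le hφ (div_pos hε hd')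
      (div_le_div_of_nonneg_right hδ hd'.le)).trans ?_
    rw [div_div_div_cancel_right₀ hd'.ne']
    gcongr
    exact lintegral_heatKernel_sqIncr_le_rateJ (div_pos hε hd') hφ h0 hfin
  calc ∫⁻ z, ENNReal.ofReal (heatKernel (δ / d) z) * absIncr φ z
      ≤ ∫⁻ z, (ENNReal.ofReal (1 / √δ / 2) *
            (ENNReal.ofReal (heatKernel (δ / d) z) * sqIncr φ z) +
          ENNReal.ofReal (heatKernel (δ / d) z) * (ENNReal.ofReal (2 / (1 / √δ)) * m)) := by
        refine lintegral_mono fun z => ?_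
        refine (mul_le_mul_right (absIncr_le hφ (one_div_pos.2 hsd) z) _).trans (le_of_eq ?_)
        rw [mul_add, mul_left_comm]
    _ = ENNReal.ofReal (1 / √δ / 2) *
          (∫⁻ z, ENNReal.ofReal (heatKernel (δ / d) z) * sqIncr φ z) +
            ENNReal.ofReal (2 * √δ) * m := by
        rw [lintegral_add_left (by fun_prop), lintegral_const_mul' _ _ ENNReal.ofReal_ne_top,
          lintegral_mul_const _ (by fun_prop), lintegral_heatKernel (div_pos hδ0 hd'), one_mul,
          div_div_eq_mul_div, div_one]
    _ ≤ ENNReal.ofReal (1 / √δ / 2) * (ENNReal.ofReal (A * (δ / ε)) * (2 * J)) +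
            ENNReal.ofReal (2 * √δ) * m := by gcongr
    _ = smoothBound d ε δ J m := by
        rw [smoothBound, ← hA, ← mul_assoc, ← mul_assoc, ← ENNReal.ofReal_mul (by positivity)]
        congr 2
        have h2 : (2 : ℝ≥0∞) = ENNReal.ofReal 2 := by simp
        rw [h2, ← ENNReal.ofReal_mul (by positivity)]
        congr 1
        field_simp
        rw [Real.sq_sqrt hδ0.le]

theorem Gam_GamSmooth_bounds (hd : 0 < d) {κ ε δ : ℝ} (hε : 0 < ε) (hδ : ε ≤ δ)
    {α : Measure (E d)} [IsFiniteMeasure α] (hJ : rateJ (ε / d) α ≠ ⊤) :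
    Gam κ α ≤ GamSmooth κ δ α +
        ENNReal.ofReal κ * smoothBound d ε δ (rateJ (ε / d) α) (α Set.univ) ∧
      GamSmooth κ δ α ≤ Gam κ α +
        ENNReal.ofReal κ * smoothBound d ε δ (rateJ (ε / d) α) (α Set.univ) := by
  have hd' : (0 : ℝ) < d := by exact_mod_cast hd
  have hmass := measure_ne_top α Set.univ
  obtain ⟨φ, hφ, h0, rfl⟩ :=
    exists_sqrt_density (absolutelyContinuous_of_rateJ_ne_top (div_pos hε hd') hJ)
  rw [withDensity_apply _ MeasurableSet.univ, Measure.restrict_univ] at hmass ⊢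
  have hL := mul_le_mul_right (lintegral_heatKernel_absIncr_le hd hε hδ hφ h0 hmass)
    (ENNReal.ofReal κ)
  have hq := (measurable_heatKernel (d := d) (δ / d)).ennreal_ofReal
  have hq1 := lintegral_heatKernel (d := d) (div_pos (hε.trans_le hδ) hd')
  rw [Gam_withDensity κ hφ]
  -- `GamSmooth` is by definition `smoothedGam` with the heat kernel as `q`.
  exact ⟨(lintegral_oneSubExpNeg_le_smoothedGam_add κ hφ hq hq1).trans (add_le_add le_rfl hL),
    (smoothedGam_le_lintegral_oneSubExpNeg_add κ hφ hq hq1).trans (add_le_add le_rfl hL)⟩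

/-- The analogue of `smoothBound` for the time average over `(0, ε]`, where times below `η ε` are
estimated trivially. -/
noncomputable def avgBound (d : ℕ) (ε η : ℝ) (J m : ℝ≥0∞) : ℝ≥0∞ :=
  ENNReal.ofReal (2 * η) * m + ENNReal.ofReal ((1 / η) ^ ((d : ℝ) / 2)) * smoothBound d ε ε J m

theorem Gam_Psi_bounds (hd : 0 < d) {κ ε η : ℝ} (hκ : 0 < κ) (hε : 0 < ε) (hη : 0 < η)
    (hη1 : η ≤ 1) {α : Measure (E d)} [IsFiniteMeasure α] (hJ : rateJ (ε / d) α ≠ ⊤) :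
    Gam κ α ≤ Psi κ ε α +
        ENNReal.ofReal κ * avgBound d ε η (rateJ (ε / d) α) (α Set.univ) ∧
      Psi κ ε α ≤ Gam κ α +
        ENNReal.ofReal κ * avgBound d ε η (rateJ (ε / d) α) (α Set.univ) := by
  have hd' : (0 : ℝ) < d := by exact_mod_cast hd
  have hmass := measure_ne_top α Set.univ
  rw [Psi_eq_smoothedGam hκ]
  obtain ⟨φ, hφ, h0, rfl⟩ :=
    exists_sqrt_density (absolutelyContinuous_of_rateJ_ne_top (div_pos hε hd') hJ)
  rw [withDensity_apply _ MeasurableSet.univ, Measure.restrict_univ] at hmass ⊢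
  have ham := measurable_absIncr hφ
  have hqη := measurable_timeAvgKernel (d := d) ε (η * ε)
  have hL : ∫⁻ z, timeAvgKernel ε ε z * absIncr φ z ≤ avgBound d ε η
      (rateJ (ε / d) (volume.withDensity fun x => ENNReal.ofReal (φ x ^ 2)))
      (∫⁻ x, ENNReal.ofReal (φ x ^ 2)) := by
    calc ∫⁻ z, timeAvgKernel ε ε z * absIncr φ z
        ≤ ∫⁻ z, (timeAvgKernel ε (η * ε) z * (2 * ∫⁻ x, ENNReal.ofReal (φ x ^ 2)) +
            ENNReal.ofReal ((1 / η) ^ ((d : ℝ) / 2)) *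
              (ENNReal.ofReal (heatKernel (ε / d) z) * absIncr φ z)) := by
          refine lintegral_mono fun z => ?_
          refine (mul_le_mul_left (timeAvgKernel_le hd hε hη hη1 z) _).trans ?_
          rw [add_mul, mul_assoc (ENNReal.ofReal _)]
          gcongr
          exact absIncr_le_two_mul hφ z
      _ = ENNReal.ofReal (2 * η) * (∫⁻ x, ENNReal.ofReal (φ x ^ 2)) +
            ENNReal.ofReal ((1 / η) ^ ((d : ℝ) / 2)) *
              ∫⁻ z, ENNReal.ofReal (heatKernel (ε / d) z) * absIncr φ z := by
          rw [lintegral_add_left (by fun_prop), lintegral_mul_const _ hqη,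
            lintegral_timeAvgKernel hd hε, lintegral_const_mul' _ _ ENNReal.ofReal_ne_top,
            mul_div_cancel_right₀ _ hε.ne', ENNReal.ofReal_mul zero_le_two, ENNReal.ofReal_ofNat,
            ← mul_assoc, mul_comm (ENNReal.ofReal η)]
      _ ≤ _ := by
          rw [avgBound]
          gcongr
          exact lintegral_heatKernel_absIncr_le hd hε le_rfl hφ h0 hmass
  have hL' := mul_le_mul_right hL (ENNReal.ofReal κ)
  have hq := measurable_timeAvgKernel (d := d) ε ε
  have hq1 : ∫⁻ z : E d, timeAvgKernel ε ε z = 1 := by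
    rw [lintegral_timeAvgKernel hd hε, div_self hε.ne', ENNReal.ofReal_one]
  rw [Gam_withDensity κ hφ]
  exact ⟨(lintegral_oneSubExpNeg_le_smoothedGam_add κ hφ hq hq1).trans (add_le_add le_rfl hL'),
    (smoothedGam_le_lintegral_oneSubExpNeg_add κ hφ hq hq1).trans (add_le_add le_rfl hL')⟩

/-! ### Collections of orbits -/

theorem Orbit.Γ_le (hd : 0 < d) {ε : ℝ} (κ : ℝ) (hε : 0 < ε) (o : Orbit d)
    (hJ : o.J (ε / d) ≠ ⊤) : o.Γ κ ≤ ENNReal.ofReal κ * o.mass := by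
  have hd' : (0 : ℝ) < d := by exact_mod_cast hd
  induction o using Quotient.ind with
  | _ α =>
    have : IsFiniteMeasure α.1 := ⟨lt_of_le_of_lt α.2 ENNReal.one_lt_top⟩
    exact Gam_le κ (absolutelyContinuous_of_rateJ_ne_top (div_pos hε hd') hJ)

theorem Orbit.Γ_Γδ_bounds (hd : 0 < d) {κ ε δ : ℝ} (hε : 0 < ε) (hδ : ε ≤ δ) (o : Orbit d)
    (hJ : o.J (ε / d) ≠ ⊤) :
    o.Γ κ ≤ o.Γδ κ δ + ENNReal.ofReal κ * smoothBound d ε δ (o.J (ε / d)) o.mass ∧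
      o.Γδ κ δ ≤ o.Γ κ + ENNReal.ofReal κ * smoothBound d ε δ (o.J (ε / d)) o.mass := by
  induction o using Quotient.ind with
  | _ α =>
    have : IsFiniteMeasure α.1 := ⟨lt_of_le_of_lt α.2 ENNReal.one_lt_top⟩
    exact Gam_GamSmooth_bounds hd hε hδ hJ

theorem Orbit.Γ_Ψ_bounds (hd : 0 < d) {κ ε η : ℝ} (hκ : 0 < κ) (hε : 0 < ε) (hη : 0 < η)
    (hη1 : η ≤ 1) (o : Orbit d) (hJ : o.J (ε / d) ≠ ⊤) :
    o.Γ κ ≤ o.Ψ κ ε + ENNReal.ofReal κ * avgBound d ε η (o.J (ε / d)) o.mass ∧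
      o.Ψ κ ε ≤ o.Γ κ + ENNReal.ofReal κ * avgBound d ε η (o.J (ε / d)) o.mass := by
  induction o using Quotient.ind with
  | _ α =>
    have : IsFiniteMeasure α.1 := ⟨lt_of_le_of_lt α.2 ENNReal.one_lt_top⟩
    exact Gam_Psi_bounds hd hκ hε hη hη1 hJ

/-- Linearity of the error in rate and mass is what makes the bound independent of the number of
orbits. -/
theorem XTilde.sum_le_add {t : ℝ} {ξ : XTilde d} {c : ℝ≥0∞} (hc : c ≠ ⊤) (hξ : ξ.J t ≤ c)
    {F G : Orbit d → ℝ≥0∞} {a b : ℝ≥0∞}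
    (h : ∀ o : Orbit d, o.J t ≠ ⊤ → F o ≤ G o + (a * o.J t + b * o.mass)) :
    ξ.sum F ≤ ξ.sum G + (a * c + b * 1) := by
  induction ξ using Quotient.ind with
  | _ ξ =>
    have hξ' : ∑' i, (ξ.orbit i).J t ≤ c := hξ
    have hfin := ENNReal.ne_top_of_tsum_ne_top (ne_top_of_le_ne_top hc hξ')
    change ∑' i, F (ξ.orbit i) ≤ ∑' i, G (ξ.orbit i) + _
    calc ∑' i, F (ξ.orbit i)
        ≤ ∑' i, (G (ξ.orbit i) + (a * (ξ.orbit i).J t + b * (ξ.orbit i).mass)) :=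
          ENNReal.tsum_le_tsum fun i => h _ (hfin i)
      _ = ∑' i, G (ξ.orbit i) +
            (a * ∑' i, (ξ.orbit i).J t + b * ∑' i, (ξ.orbit i).mass) := by
          rw [ENNReal.tsum_add, ENNReal.tsum_add, ENNReal.tsum_mul_left, ENNReal.tsum_mul_left]
      _ ≤ _ := by
          gcongr
          exact ξ.mass_le

theorem absDiff_le {x y c : ℝ≥0∞} (hx : x ≠ ⊤) (hc : c ≠ ⊤) (h1 : x ≤ y + c) (h2 : y ≤ x + c) :
    absDiff x y ≤ c := by
  have hy : y ≠ ⊤ := ne_top_of_le_ne_top (ENNReal.add_ne_top.2 ⟨hx, hc⟩) h2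
  lift x to NNReal using hx
  lift y to NNReal using hy
  lift c to NNReal using hc
  have h1' : (x : ℝ) ≤ y + c := by exact_mod_cast h1
  have h2' : (y : ℝ) ≤ x + c := by exact_mod_cast h2
  have h3 : ((x : ℝ≥0∞) : EReal) - ((y : ℝ≥0∞) : EReal) = (((x : ℝ) - (y : ℝ) : ℝ) : EReal) := by
    rw [EReal.coe_sub]
    rfl
  rw [absDiff, h3, EReal.abs_def, ← ENNReal.ofReal_coe_nnreal]
  exact ENNReal.ofReal_le_ofReal (abs_le.2 ⟨by linarith, by linarith⟩)

theorem XTilde.Γ_ne_top (hd : 0 < d) {ε : ℝ} (κ : ℝ) (hε : 0 < ε) {ξ : XTilde d} {c : ℝ≥0∞}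
    (hc : c ≠ ⊤) (hξ : ξ.J (ε / d) ≤ c) : ξ.Γ κ ≠ ⊤ := by
  refine ENNReal.add_ne_top.2 ⟨?_, ENNReal.mul_ne_top ENNReal.ofReal_ne_top
    (ENNReal.sub_ne_top ENNReal.one_ne_top)⟩
  have h := XTilde.sum_le_add hc hξ (F := Orbit.Γ κ) (G := fun _ => 0) (a := 0)
    (b := ENNReal.ofReal κ) fun o ho => by simpa using Orbit.Γ_le hd κ hε o ho
  refine ne_top_of_le_ne_top ?_ h
  have h0 : ξ.sum (fun _ => 0) = 0 := by
    induction ξ using Quotient.ind with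
    | _ ξ => exact tsum_zero
  simp [h0]

/-- Comparison of `Γ̃` with a functional of the same form whose summands are close. -/
theorem XTilde.absDiff_le (hd : 0 < d) {ε κ : ℝ} (hε : 0 < ε) {ξ : XTilde d} {c : ℝ≥0∞}
    (hc : c ≠ ⊤) (hξ : ξ.J (ε / d) ≤ c) {G : Orbit d → ℝ≥0∞} {a b : ℝ≥0∞} (ha : a ≠ ⊤)
    (hb : b ≠ ⊤)
    (h : ∀ o : Orbit d, o.J (ε / d) ≠ ⊤ →
      o.Γ κ ≤ G o + (a * o.J (ε / d) + b * o.mass) ∧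
      G o ≤ o.Γ κ + (a * o.J (ε / d) + b * o.mass)) :
    absDiff (ξ.Γ κ) (ξ.sum G + ξ.deficit κ) ≤ a * c + b * 1 := by
  have h1 := XTilde.sum_le_add hc hξ fun o ho => (h o ho).1
  have h2 := XTilde.sum_le_add hc hξ fun o ho => (h o ho).2
  refine SwissCheese.absDiff_le (XTilde.Γ_ne_top hd κ hε hc hξ) (by finiteness) ?_ ?_
  -- The deficit is the same on both sides and plays no part in the error.
  · rw [add_right_comm]
    exact add_le_add h1 le_rfl
  · rw [XTilde.Γ, add_right_comm]
    exact add_le_add h2 le_rfl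

/-- The budget `K ε` cancels the `1 / ε` of the form comparison, leaving a constant uniform in `ε ≤
δ`. -/
theorem smoothBound_ofReal {ε δ K : ℝ} (hε : 0 < ε) (hK : 0 < K) :
    smoothBound d ε δ (ENNReal.ofReal (K * ε)) 1 =
      ENNReal.ofReal (((4 : ℝ) ^ ((d : ℝ) / 2) * 4 * K + 2) * √δ) := by
  rw [smoothBound, mul_one, ← ENNReal.ofReal_mul (by positivity),
    ← ENNReal.ofReal_add (by positivity) (by positivity)]
  congr 1
  field_simp

theorem XTilde.absDiff_Γ_Γδ_le (hd : 0 < d) {κ K ε δ : ℝ} (hκ : 0 < κ) (hK : 0 < K) (hε : 0 < ε)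
    (hδ : ε ≤ δ) {ξ : XTilde d} (hξ : ξ.J (ε / d) ≤ ENNReal.ofReal (K * ε)) :
    absDiff (ξ.Γ κ) (ξ.Γδ κ δ) ≤
      ENNReal.ofReal (κ * ((4 : ℝ) ^ ((d : ℝ) / 2) * 4 * K + 2) * √δ) := by
  -- Exposes the coefficients of `J` and `m` for the summation over orbits.
  have hlin : ∀ J m : ℝ≥0∞, ENNReal.ofReal κ * smoothBound d ε δ J m =
      ENNReal.ofReal κ * ENNReal.ofReal ((4 : ℝ) ^ ((d : ℝ) / 2) * 4 * √δ / ε) * J +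
        ENNReal.ofReal κ * ENNReal.ofReal (2 * √δ) * m := fun J m => by
    rw [smoothBound]
    ring
  refine (XTilde.absDiff_le hd hε ENNReal.ofReal_ne_top hξ
    (a := ENNReal.ofReal κ * ENNReal.ofReal ((4 : ℝ) ^ ((d : ℝ) / 2) * 4 * √δ / ε))
    (b := ENNReal.ofReal κ * ENNReal.ofReal (2 * √δ)) (by finiteness) (by finiteness)
    fun o ho => ?_).trans (le_of_eq ?_)
  · rw [← hlin]
    exact Orbit.Γ_Γδ_bounds hd hε hδ o ho
  · rw [← hlin, smoothBound_ofReal hε hK, ← ENNReal.ofReal_mul hκ.le, mul_assoc κ]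

theorem XTilde.absDiff_Γ_Ψ_le (hd : 0 < d) {κ K ε η : ℝ} (hκ : 0 < κ) (hK : 0 < K) (hε : 0 < ε)
    (hη : 0 < η) (hη1 : η ≤ 1) {ξ : XTilde d} (hξ : ξ.J (ε / d) ≤ ENNReal.ofReal (K * ε)) :
    absDiff (ξ.Γ κ) (ξ.Ψ κ ε) ≤
      ENNReal.ofReal (κ * (2 * η + (1 / η) ^ ((d : ℝ) / 2) *
        (((4 : ℝ) ^ ((d : ℝ) / 2) * 4 * K + 2) * √ε))) := by
  set H : ℝ := (1 / η) ^ ((d : ℝ) / 2) with hH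
  have hH0 : 0 ≤ H := by positivity
  have hlin : ∀ J m : ℝ≥0∞, ENNReal.ofReal κ * avgBound d ε η J m =
      ENNReal.ofReal κ * (ENNReal.ofReal H *
        ENNReal.ofReal ((4 : ℝ) ^ ((d : ℝ) / 2) * 4 * √ε / ε)) * J +
        ENNReal.ofReal κ *
          (ENNReal.ofReal (2 * η) + ENNReal.ofReal H * ENNReal.ofReal (2 * √ε)) * m :=
    fun J m => by
      rw [avgBound, smoothBound]
      ring
  refine (XTilde.absDiff_le hd hε ENNReal.ofReal_ne_top hξ
    (a := ENNReal.ofReal κ * (ENNReal.ofReal H *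
        ENNReal.ofReal ((4 : ℝ) ^ ((d : ℝ) / 2) * 4 * √ε / ε)))
    (b := ENNReal.ofReal κ *
          (ENNReal.ofReal (2 * η) + ENNReal.ofReal H * ENNReal.ofReal (2 * √ε)))
    (by finiteness) (by finiteness) fun o ho => ?_).trans (le_of_eq ?_)
  · rw [← hlin]
    exact Orbit.Γ_Ψ_bounds hd hκ hε hη hη1 o ho
  · rw [← hlin, avgBound, smoothBound_ofReal hε hK, ← hH, mul_one, ← ENNReal.ofReal_mul hH0,
      ← ENNReal.ofReal_add (by positivity) (by positivity), ← ENNReal.ofReal_mul hκ.le]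

end SwissCheese

/-! ### Conclusion: uniform bounds and the limit -/

theorem mainTheorem6 (d : ℕ) (hd : 3 ≤ d) (κ : ℝ) (hκ : 0 < κ) (K : ℝ) (hK : 0 < K) :
    Tendsto
      (fun ε : ℝ => ⨆ (ξ : SwissCheese.XTilde d) (_ : ξ.J (ε / d) ≤ ENNReal.ofReal (K * ε)),
        SwissCheese.absDiff (ξ.Γ κ) (ξ.Ψ κ ε))
      (𝓝[>] 0) (𝓝 0) ∧
    ∃ C : ℝ, 0 < C ∧ ∀ ε δ : ℝ, 0 < ε → ε ≤ δ →
      (⨆ (ξ : SwissCheese.XTilde d) (_ : ξ.J (ε / d) ≤ ENNReal.ofReal (K * ε)),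
        SwissCheese.absDiff (ξ.Γ κ) (ξ.Γδ κ δ)) ≤ ENNReal.ofReal (C * √δ) := by
  have hd0 : 0 < d := by omega
  refine ⟨?_, κ * ((4 : ℝ) ^ ((d : ℝ) / 2) * 4 * K + 2), by positivity, fun ε δ hε hδ =>
    iSup₂_le fun ξ hξ => SwissCheese.XTilde.absDiff_Γ_Γδ_le hd0 hκ hK hε hδ hξ⟩
  refine ENNReal.tendsto_nhds_zero.2 fun e he => ?_
  rcases eq_or_ne e ⊤ with rfl | hetop
  · exact .of_forall fun _ => le_top
  have hr : 0 < e.toReal := ENNReal.toReal_pos he.ne' hetop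
  -- With this `η` the short-time error `2 κ η` is at most half of `e`. The remaining term vanishes
  -- as `ε → 0` at fixed `η`.
  set η : ℝ := min 1 (e.toReal / (4 * κ)) with hη
  have hη0 : 0 < η := lt_min one_pos (by positivity)
  have hη1 : η ≤ 1 := min_le_left _ _
  have hη2 : κ * (2 * η) < e.toReal := by
    have h : η ≤ e.toReal / (4 * κ) := min_le_right _ _
    rw [le_div_iff₀ (by positivity)] at h
    linarith
  have hcont : Continuous fun ε : ℝ => κ * (2 * η + (1 / η) ^ ((d : ℝ) / 2) *
      (((4 : ℝ) ^ ((d : ℝ) / 2) * 4 * K + 2) * √ε)) := by fun_prop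
  have hlim := hcont.tendsto 0
  simp only [Real.sqrt_zero, mul_zero, add_zero] at hlim
  filter_upwards [self_mem_nhdsWithin, nhdsWithin_le_nhds (hlim.eventually_lt_const hη2)]
    with ε hε hlt
  refine iSup₂_le fun ξ hξ =>
    (SwissCheese.XTilde.absDiff_Γ_Ψ_le hd0 hκ hK hε hη0 hη1 hξ).trans ?_
  rw [← ENNReal.ofReal_toReal hetop]
  exact ENNReal.ofReal_le_ofReal hlt.le
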